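/- Let $n\ge 1$, let $\mathbb F$ be a field, and let $V=\bigoplus_{m\in\mathbb Z/n}V_m$ be a finite-dimensional $\mathbb F$-vector space with a fixed decomposition into subspaces. Put $\xi(V)=(\dim V_m)_{m}$, $K=\prod_m GL(V_m)$, $\widetilde V=\bigcup_m V_m$, and let $\mathcal N$ be the set of nilpotent $x\in\operatorname{End}V$ with $xV_m\subset V_{m+1}$ for all $m$; $K$ acts on $V\times\mathcal N$ by $k\cdot(v,x)=(kv,kxk^{-1})$. **Combinatorial objects.** A *colored partition* is a pair $(\lambda,\epsilon)$ with $\lambda=(\lambda_1\ge\lambda_2\ge\cdots)$ a sequence of nonnegative integers that is eventually $0$, and $\epsilon:\{1,2,\dots\}\to\mathbb Z/n$ a function taking each value infinitely often. Its length is $l(\lambda)=\#\{i:\lambda_i>0\}$, and its signature is $\xi_m(\lambda,\epsilon)=\#\{(i,j): 1\le j\le\lambda_i,\ \epsilon_i+[\lambda_i-j]=m\}$, $m\in\mathbb Z/n$. A *marked colored partition* $(\lambda,\epsilon,\mu)$ has in addition integers $\mu_i\le\lambda_i$. Two (marked) colored partitions are equivalent if one is obtained from the other by a permutation of the rows $i\in\{1,2,\dots\}$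 (with their colors and marks). Let $\mathcal P_n$ and $\mathcal P_n^{\mathrm m}$ be the sets of equivalence classes; $\mathcal P_n\hookrightarrow\mathcal P_n^{\mathrm m}$ via $(\lambda,\epsilon)\mapsto(\lambda,\epsilon,0)$. The operation $\cup$ on $\mathcal P_n^{\mathrm m}$ interlaces the rows of two marked colored partitions and then permutes them so that the lengths are weakly decreasing. **The map $\Psi$.** Suppose $(\lambda,\epsilon,\mu)$ has signature $\xi(\lambda,\epsilon)=\xi(V)$. Choose $x\in\mathcal N$ and a basis $\{v_{i,j}:1\le j\le\lambda_i\}$ of $V$ with $v_{i,j}\in V_{\epsilon_i+[\lambda_i-j]}$, $xv_{i,j}=v_{i,j-1}$ for $j>1$ and $xv_{i,1}=0$. Put $v_{i,j}=0$ for $j\le 0$. Then $\Psi(\lambda,\epsilon,\mu)$ is the $K$-orbit of $\bigl(\sum_{i\le l(\lambda)}v_{i,\mu_i},\,x\bigr)$; it depends only on the class of $(\lambda,\epsilon,\mu)$. **Characteristic colored bipartitions.** Call a marking $\mu\ge 0$ of a colored partition $(\lambda,\epsilon)$ of signature $\xi(V)$ *minimal* if every marking $\delta$ with $0\le\delta_i\le\mu_i$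 for all $i$ and $\Psi(\lambda,\epsilon,\delta)=\Psi(\lambda,\epsilon,\mu)$ equals $\mu$. Deleting from such a $(\lambda,\epsilon,\mu)$ all rows with $\lambda_i>0$ and $\mu_i=0$ gives a marked colored partition $(\alpha,\beta,\gamma)$. If $\beta_i+[\alpha_i-\gamma_i]=\beta_j+[\alpha_j-\gamma_j]$ for all $1\le i<j\le l(\alpha)$, then $(\alpha,\beta,\gamma)$, and any marked colored partition equivalent to it, is called a *characteristic colored bipartition*. **Statement.** The map $((\lambda,\epsilon,\mu),(\alpha,\beta))\mapsto\Psi\bigl((\lambda,\epsilon,\mu)\cup(\alpha,\beta,0)\bigr)$ is a bijection from the set of pairs in $\mathcal P_n^{\mathrm m}\times\mathcal P_n$ such that $\xi(\lambda,\epsilon)+\xi(\alpha,\beta)=\xi(V)$ and $(\lambda,\epsilon,\mu)$ is a characteristic colored bipartition, onto the set $K\backslash(\widetilde V\times\mathcal N)$ of $K$-orbits. Moreover, a marked colored partition $(\lambda,\epsilon,\mu)$ is a characteristic colored bipartition if and only if $\xi(\lambda,\epsilon)\le\xi(V)$ (componentwise), $\mu_i>0$ for $i\le l(\lambda)$, $\mu_i=0$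 for $i>l(\lambda)$, and for all $1\le i<j\le l(\lambda)$: $\epsilon_i+[\lambda_i-\mu_i]=\epsilon_j+[\lambda_j-\mu_j]$, $\mu_i>\mu_j$ and $\lambda_i-\mu_i>\lambda_j-\mu_j$. -/

import Mathlib

/-! ### Colored partitions

Rows are indexed by `ℕ`, starting with row `0`; the columns of a Young diagram start with `1`. -/

/-- An `n`-colored partition: a weakly decreasing sequence `len` of row lengths that reaches `0`,
with a color in `ZMod n` for each row, each color being used by infinitely many rows. -/
structure ColoredPartition (n : ℕ) where
  len : ℕ → ℕ
  color : ℕ → ZMod n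
  antitone_len : Antitone len
  exists_len_eq_zero : ∃ i, len i = 0
  infinite_color : ∀ m : ZMod n, {i | color i = m}.Infinite

/-- A marked colored partition: a colored partition with an integer `mark i ≤ len i` in each row. -/
structure MarkedColoredPartition (n : ℕ) extends ColoredPartition n where
  mark : ℕ → ℤ
  mark_le : ∀ i, mark i ≤ len i

namespace ColoredPartition

variable {n : ℕ}

theorem finite_support (p : ColoredPartition n) : {i | 0 < p.len i}.Finite := by
  obtain ⟨N, hN⟩ := p.exists_len_eq_zero
  refine (Set.finite_lt_nat N).subset fun i hi => ?_
  by_contra h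
  have h1 := p.antitone_len (not_lt.mp h)
  have h2 : 0 < p.len i := hi
  omega

/-- The number of nonzero rows. -/
noncomputable def length (p : ColoredPartition n) : ℕ := {i | 0 < p.len i}.ncard

/-- The boxes `(i, j)` of the Young diagram (row `i`, column `j`). -/
abbrev Box (p : ColoredPartition n) : Type := {b : ℕ × ℕ // 1 ≤ b.2 ∧ b.2 ≤ p.len b.1}

/-- The color of the box `(i, j)` is `ε i + [λ i - j]`. -/
def boxColor (p : ColoredPartition n) (b : p.Box) : ZMod n :=
  p.color b.1.1 + ((p.len b.1.1 - b.1.2 : ℕ) : ZMod n)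

/-- The signature: the number of boxes of each color. -/
noncomputable def signature (p : ColoredPartition n) (m : ZMod n) : ℕ :=
  Nat.card {b : p.Box // p.boxColor b = m}

/-- Equivalence: a permutation of the rows (necessarily between rows of the same length). -/
def RowEquiv (p q : ColoredPartition n) : Prop :=
  ∃ σ : Equiv.Perm ℕ, q.len = p.len ∘ σ ∧ q.color = p.color ∘ σ

instance setoid (n : ℕ) : Setoid (ColoredPartition n) where
  r := RowEquiv
  iseqv :=
    { refl := fun _ => ⟨1, rfl, rfl⟩
      symm := by
        rintro p q ⟨σ, h1, h2⟩
        exact ⟨σ⁻¹, by rw [h1]; ext; simp, by rw [h2]; ext; simp⟩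
      trans := by
        rintro p q r ⟨σ, h1, h2⟩ ⟨τ, h3, h4⟩
        exact ⟨σ * τ, by rw [h3, h1]; rfl, by rw [h4, h2]; rfl⟩ }

/-- A row permutation induces a bijection between the boxes. -/
def boxEquiv {p q : ColoredPartition n} (σ : Equiv.Perm ℕ) (h : q.len = p.len ∘ σ) :
    q.Box ≃ p.Box where
  toFun b := ⟨(σ b.1.1, b.1.2), b.2.1, by have := congrFun h b.1.1 ▸ b.2.2; exact this⟩
  invFun b := ⟨(σ.symm b.1.1, b.1.2), b.2.1, by have := b.2.2; simpa [h] using this⟩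
  left_inv b := by apply Subtype.ext; simp
  right_inv b := by apply Subtype.ext; simp

theorem boxColor_boxEquiv {p q : ColoredPartition n} (σ : Equiv.Perm ℕ) (h : q.len = p.len ∘ σ)
    (hc : q.color = p.color ∘ σ) (b : q.Box) : p.boxColor (boxEquiv σ h b) = q.boxColor b := by
  simp [boxColor, boxEquiv, h, hc]

theorem signature_eq {p q : ColoredPartition n} (h : p.RowEquiv q) :
    p.signature = q.signature := by
  obtain ⟨σ, h1, h2⟩ := h
  funext m
  exact (Nat.card_congr ((boxEquiv σ h1).subtypeEquiv fun b => by
    rw [boxColor_boxEquiv σ h1 h2])).symm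

theorem length_eq {p q : ColoredPartition n} (h : p.RowEquiv q) : p.length = q.length := by
  obtain ⟨σ, h1, -⟩ := h
  refine (Set.ncard_congr (fun a _ => σ a) ?_ ?_ ?_).symm
  · intro a ha
    simpa [h1] using ha
  · intro a b _ _ hab
    exact σ.injective hab
  · intro b hb
    exact ⟨σ.symm b, by simpa [h1] using hb, by simp⟩

theorem lt_length_iff (p : ColoredPartition n) (i : ℕ) : i < p.length ↔ 0 < p.len i := by
  classical
  have key : ∃ N, {i | 0 < p.len i} = Set.Iio N := by
    refine ⟨Nat.find p.exists_len_eq_zero, ?_⟩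
    ext k
    simp only [Set.mem_ofPred_eq, Set.mem_Iio, Nat.lt_find_iff]
    constructor
    · intro hk m hm h0
      have := p.antitone_len hm
      omega
    · intro hk
      have := hk k le_rfl
      omega
  obtain ⟨N, hN⟩ := key
  have hl : p.length = N := by
    rw [length, hN, ← Finset.coe_Iio, Set.ncard_coe_finset, Nat.card_Iio]
  rw [hl]
  have : i ∈ {i | 0 < p.len i} ↔ i ∈ Set.Iio N := by rw [hN]
  exact this.symm

end ColoredPartition

/-- The set `P_n` of equivalence classes of `n`-colored partitions. -/
def ColoredPartitionClass (n : ℕ) : Type := Quotient (ColoredPartition.setoid n)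

/-- The signature of a class of colored partitions. -/
noncomputable def ColoredPartitionClass.signature {n : ℕ} (c : ColoredPartitionClass n) :
    ZMod n → ℕ :=
  Quotient.lift ColoredPartition.signature (fun _ _ h => ColoredPartition.signature_eq h) c

/-! ### Interlacing, sorting and deleting rows -/

/-- Interlace two sequences, starting with `g 0, f 0, g 1, f 1, …`. -/
def interlace {α : Type*} (f g : ℕ → α) (k : ℕ) : α :=
  if Even k then g (k / 2) else f (k / 2)

theorem interlace_eq {α : Type*} (f g : ℕ → α) :
    interlace f g = Sum.elim g f ∘ Equiv.natSumNatEquivNat.symm := by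
  rw [Equiv.eq_comp_symm]
  funext s
  rcases s with a | a
  · simp [interlace]
  · have h : (2 * a + 1) / 2 = a := by omega
    simp [interlace, h]

theorem exists_perm_antitone (f : ℕ → ℕ) (hf : ∃ N, ∀ i, N ≤ i → f i = 0) :
    ∃ σ : Equiv.Perm ℕ, Antitone (f ∘ σ) := by
  obtain ⟨N, hN⟩ := hf
  let g : Fin N → ℕᵒᵈ := fun i => OrderDual.toDual (f i)
  let e : Fin N ≃ {i : ℕ // i < N} := Fin.equivSubtype
  let σ : Equiv.Perm ℕ := (Tuple.sort g).extendDomain e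
  have hlt : ∀ i (h : i < N), σ i = (Tuple.sort g ⟨i, h⟩ : ℕ) := by
    intro i h
    exact Equiv.Perm.extendDomain_apply_subtype (Tuple.sort g) e h
  have hge : ∀ i, N ≤ i → σ i = i := by
    intro i h
    exact Equiv.Perm.extendDomain_apply_not_subtype (Tuple.sort g) e (not_lt.mpr h)
  refine ⟨σ, fun i j hij => ?_⟩
  by_cases hj : j < N
  · have hi : i < N := lt_of_le_of_lt hij hj
    have := Tuple.monotone_sort g (show (⟨i, hi⟩ : Fin N) ≤ ⟨j, hj⟩ from hij)
    simp only [Function.comp_apply, hlt i hi, hlt j hj]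
    exact this
  · simp only [Function.comp_apply]
    rw [hge j (not_lt.mp hj), hN j (not_lt.mp hj)]
    exact Nat.zero_le _

theorem infinite_preimage_perm {α : Type*} {c : ℕ → α} {m : α} (h : {i | c i = m}.Infinite)
    (σ : Equiv.Perm ℕ) : {i | (c ∘ σ) i = m}.Infinite := by
  intro hfin
  refine h ((hfin.image σ).subset fun i hi => ⟨σ.symm i, ?_, by simp⟩)
  simpa using hi

theorem infinite_interlace {α : Type*} {c d : ℕ → α} {m : α} (h : {i | c i = m}.Infinite) :
    {i | interlace c d i = m}.Infinite := by
  refine (h.image (f := fun i => 2 * i + 1) (fun a _ b _ hab => by simpa using hab)).mono ?_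
  rintro _ ⟨i, hi, rfl⟩
  have h2 : (2 * i + 1) / 2 = i := by omega
  simpa [interlace, h2] using hi

namespace MarkedColoredPartition

variable {n : ℕ}

/-- Row-equivalence: a permutation of the rows together with their marks. -/
def RowEquiv (p q : MarkedColoredPartition n) : Prop :=
  ∃ σ : Equiv.Perm ℕ, q.len = p.len ∘ σ ∧ q.color = p.color ∘ σ ∧ q.mark = p.mark ∘ σ

instance setoid (n : ℕ) : Setoid (MarkedColoredPartition n) where
  r := RowEquiv
  iseqv :=
    { refl := fun _ => ⟨1, rfl, rfl, rfl⟩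
      symm := by
        rintro p q ⟨σ, h1, h2, h3⟩
        exact ⟨σ⁻¹, by rw [h1]; ext; simp, by rw [h2]; ext; simp, by rw [h3]; ext; simp⟩
      trans := by
        rintro p q r ⟨σ, h1, h2, h3⟩ ⟨τ, h4, h5, h6⟩
        exact ⟨σ * τ, by rw [h4, h1]; rfl, by rw [h5, h2]; rfl, by rw [h6, h3]; rfl⟩ }

theorem RowEquiv.shape {p q : MarkedColoredPartition n} (h : p.RowEquiv q) :
    p.toColoredPartition.RowEquiv q.toColoredPartition := by
  obtain ⟨σ, h1, h2, -⟩ := h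
  exact ⟨σ, h1, h2⟩

theorem exists_sort_interlace (p q : MarkedColoredPartition n) :
    ∃ σ : Equiv.Perm ℕ, Antitone (interlace p.len q.len ∘ σ) := by
  obtain ⟨M, hM⟩ := p.exists_len_eq_zero
  obtain ⟨N, hN⟩ := q.exists_len_eq_zero
  refine exists_perm_antitone _ ⟨2 * (M + N), fun i hi => ?_⟩
  have h1 := p.antitone_len (show M ≤ i / 2 by omega)
  have h2 := q.antitone_len (show N ≤ i / 2 by omega)
  unfold interlace
  split <;> omega

/-- Interlace the rows of two marked colored partitions, then permute them so that the lengths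
decrease. -/
noncomputable def union (p q : MarkedColoredPartition n) : MarkedColoredPartition n where
  len := interlace p.len q.len ∘ (exists_sort_interlace p q).choose
  color := interlace p.color q.color ∘ (exists_sort_interlace p q).choose
  mark := interlace p.mark q.mark ∘ (exists_sort_interlace p q).choose
  antitone_len := (exists_sort_interlace p q).choose_spec
  exists_len_eq_zero := by
    obtain ⟨M, hM⟩ := p.exists_len_eq_zero
    refine ⟨(exists_sort_interlace p q).choose.symm (2 * M + 1), ?_⟩
    have h2 : (2 * M + 1) / 2 = M := by omega
    simp [interlace, h2, hM]
  infinite_color := fun m =>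
    infinite_preimage_perm (infinite_interlace (p.infinite_color m)) _
  mark_le := by
    intro i
    simp only [Function.comp_apply, interlace]
    split
    · exact q.mark_le _
    · exact p.mark_le _

theorem union_rowEquiv {p p' q q' : MarkedColoredPartition n} (hp : p.RowEquiv p')
    (hq : q.RowEquiv q') : (p.union q).RowEquiv (p'.union q') := by
  obtain ⟨σ, h1, h2, h3⟩ := hp
  obtain ⟨τ, h4, h5, h6⟩ := hq
  let ρ : Equiv.Perm ℕ :=
    (Equiv.natSumNatEquivNat.symm.trans (Equiv.sumCongr τ σ)).trans Equiv.natSumNatEquivNat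
  have key : ∀ {α : Type} (f g : ℕ → α),
      interlace (f ∘ σ) (g ∘ τ) = interlace f g ∘ ρ := by
    intro α f g
    rw [interlace_eq, interlace_eq]
    funext k
    simp only [ρ, Function.comp_apply, Equiv.trans_apply, Equiv.symm_apply_apply]
    rcases Equiv.natSumNatEquivNat.symm k with a | a <;> simp
  let s := (exists_sort_interlace p q).choose
  let s' := (exists_sort_interlace p' q').choose
  refine ⟨s'.trans (ρ.trans s.symm), ?_, ?_, ?_⟩
  · change interlace p'.len q'.len ∘ s' = _
    rw [h1, h4, key]
    funext k
    simp [union, s]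
  · change interlace p'.color q'.color ∘ s' = _
    rw [h2, h5, key]
    funext k
    simp [union, s]
  · change interlace p'.mark q'.mark ∘ s' = _
    rw [h3, h6, key]
    funext k
    simp [union, s]

/-- Delete the rows indexed by the finite set `S`; `Nat.nth (· ∉ S)` is the increasing enumeration
of the remaining rows. -/
noncomputable def deleteRows (p : MarkedColoredPartition n) (S : Set ℕ) (hS : S.Finite) :
    MarkedColoredPartition n where
  len := p.len ∘ Nat.nth (· ∉ S)
  color := p.color ∘ Nat.nth (· ∉ S)
  mark := p.mark ∘ Nat.nth (· ∉ S)
  antitone_len := p.antitone_len.comp_monotone (Nat.nth_strictMono hS.infinite_compl).monotone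
  exists_len_eq_zero := by
    obtain ⟨N, hN⟩ := p.exists_len_eq_zero
    refine ⟨N, ?_⟩
    have := p.antitone_len ((Nat.nth_strictMono (p := (· ∉ S)) hS.infinite_compl).le_apply (x := N))
    simp only [Function.comp_apply]
    omega
  infinite_color := by
    intro m hfin
    refine ((p.infinite_color m).sdiff hS) ((hfin.image (Nat.nth (· ∉ S))).subset ?_)
    rintro i ⟨hi, hiS⟩
    have hr : i ∈ Set.range (Nat.nth (· ∉ S)) := by
      rw [Nat.range_nth_of_infinite (p := (· ∉ S)) hS.infinite_compl]
      exact hiS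
    obtain ⟨k, rfl⟩ := hr
    exact ⟨k, hi, rfl⟩
  mark_le := fun i => p.mark_le _

/-- The result of deleting the nonzero rows whose mark is `0`. -/
noncomputable def deleteUnmarked (p : MarkedColoredPartition n) : MarkedColoredPartition n :=
  p.deleteRows {i | 0 < p.len i ∧ p.mark i = 0} (p.finite_support.subset fun _ hi => hi.1)

/-- The same colored partition with a new marking. -/
def withMark (p : MarkedColoredPartition n) (δ : ℕ → ℤ) (h : ∀ i, δ i ≤ p.len i) :
    MarkedColoredPartition n where
  toColoredPartition := p.toColoredPartition
  mark := δ
  mark_le := h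

/-- The color `ε i + [λ i - μ i]` attached to the mark in row `i`. -/
def markColor (p : MarkedColoredPartition n) (i : ℕ) : ZMod n :=
  p.color i + ((p.len i - p.mark i : ℤ) : ZMod n)

end MarkedColoredPartition

/-- The set of row-equivalence classes of marked `n`-colored partitions. -/
def MarkedColoredPartitionClass (n : ℕ) : Type := Quotient (MarkedColoredPartition.setoid n)

namespace MarkedColoredPartitionClass

variable {n : ℕ}

/-- The class of a marked colored partition. -/
def mk (p : MarkedColoredPartition n) : MarkedColoredPartitionClass n := Quotient.mk _ p

/-- The signature of a class of marked colored partitions. -/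
noncomputable def signature (c : MarkedColoredPartitionClass n) : ZMod n → ℕ :=
  Quotient.lift (fun p : MarkedColoredPartition n => p.toColoredPartition.signature)
    (fun _ _ h => ColoredPartition.signature_eq (MarkedColoredPartition.RowEquiv.shape h)) c

/-- The operation `∪` on classes of marked colored partitions. -/
noncomputable def union (c d : MarkedColoredPartitionClass n) : MarkedColoredPartitionClass n :=
  Quotient.map₂ MarkedColoredPartition.union
    (fun _ _ hp _ _ hq => MarkedColoredPartition.union_rowEquiv hp hq) c d

end MarkedColoredPartitionClass

/-- The embedding `(λ, ε) ↦ (λ, ε, 0)`. -/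
def ColoredPartitionClass.toMarked {n : ℕ} (c : ColoredPartitionClass n) :
    MarkedColoredPartitionClass n :=
  Quotient.map (fun p : ColoredPartition n => (⟨p, 0, fun _ => by simp⟩ : MarkedColoredPartition n))
    (fun p q (h : p.RowEquiv q) => by
      obtain ⟨σ, h1, h2⟩ := h
      exact ⟨σ, h1, h2, rfl⟩) c

/-! ### Colored vector spaces and enhanced orbits

A colored vector space is a finite-dimensional space `W` with subspaces `V m`, `m : ZMod n`, of
which it is the internal direct sum. -/

section Orbits

variable {n : ℕ} {F W : Type*} [Field F] [AddCommGroup W] [Module F W]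

/-- The signature `m ↦ dim V m` of the colored vector space. -/
noncomputable def spaceSignature (V : ZMod n → Submodule F W) (m : ZMod n) : ℕ :=
  Module.finrank F (V m)

/-- The group `K = ∏ GL(V m)`, as the group of automorphisms of `W` that preserve each `V m`. -/
def colorGroup (V : ZMod n → Submodule F W) : Subgroup (W ≃ₗ[F] W) where
  carrier := {k | ∀ m, (V m).map (k : W →ₗ[F] W) = V m}
  one_mem' := fun m => Submodule.map_id _
  mul_mem' := by
    intro a b ha hb m
    have : ((a * b : W ≃ₗ[F] W) : W →ₗ[F] W) = (a : W →ₗ[F] W).comp (b : W →ₗ[F] W) := rfl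
    rw [this, Submodule.map_comp, hb m, ha m]
  inv_mem' := by
    intro a ha m
    conv_lhs => rw [← ha m]
    rw [← Submodule.map_comp]
    have : ((a⁻¹ : W ≃ₗ[F] W) : W →ₗ[F] W).comp (a : W →ₗ[F] W) = LinearMap.id := by
      ext w
      exact a.symm_apply_apply w
    rw [this, Submodule.map_id]

/-- The colored nilpotent cone: nilpotent endomorphisms that map each `V m` into `V (m + 1)`. -/
def nilpotentCone (V : ZMod n → Submodule F W) : Set (Module.End F W) :=
  {x | IsNilpotent x ∧ ∀ m, ∀ v ∈ V m, x v ∈ V (m + 1)}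

/-- The `K`-orbit of `(v, x)`, where `k` acts by `k • (v, x) = (k v, k x k⁻¹)`. -/
def enhancedOrbit (V : ZMod n → Submodule F W) (p : W × Module.End F W) :
    Set (W × Module.End F W) :=
  {q | ∃ k ∈ colorGroup V, q = (k p.1, k.conj p.2)}

/-- The set of `K`-orbits in `Ṽ × N`, where `Ṽ` is the union of the `V m` and `N` is the colored
nilpotent cone. -/
def enhancedOrbits (V : ZMod n → Submodule F W) : Set (Set (W × Module.End F W)) :=
  {O | ∃ v x, (∃ m, v ∈ V m) ∧ x ∈ nilpotentCone V ∧ O = enhancedOrbit V (v, x)}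

/-- The vector `v_{i,j}` of a basis indexed by the boxes of a Young diagram, extended by `0`. -/
noncomputable def basisEntry {p : ColoredPartition n} (B : Module.Basis p.Box F W) (i : ℕ) (j : ℤ) :
    W :=
  if h : 1 ≤ j ∧ j ≤ p.len i then B ⟨(i, j.toNat), by dsimp only; omega, by dsimp only; omega⟩
  else 0

/-- `B` is a colored Jordan basis for `x`, of type `p`: each `v_{i,j}` lies in the subspace whose
color is that of the box `(i, j)`, and `x v_{i,j} = v_{i,j-1}`, where `v_{i,0} = 0`. -/
def IsColoredJordanBasis (V : ZMod n → Submodule F W) (x : Module.End F W) {p : ColoredPartition n}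
    (B : Module.Basis p.Box F W) : Prop :=
  (∀ b, B b ∈ V (p.boxColor b)) ∧ ∀ b, x (B b) = basisEntry B b.1.1 ((b.1.2 : ℤ) - 1)

/-- The orbit `Ψ(λ, ε, μ)`: the orbit of `(∑ i, v_{i, μ i}, x)`, for any colored Jordan basis
`v_{i,j}` of type `(λ, ε)` of any `x` in the colored nilpotent cone. -/
def Psi (V : ZMod n → Submodule F W) (p : MarkedColoredPartition n) :
    Set (W × Module.End F W) :=
  {q | ∃ x ∈ nilpotentCone V, ∃ B : Module.Basis p.toColoredPartition.Box F W,
    IsColoredJordanBasis V x B ∧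
      q ∈ enhancedOrbit V (∑ i ∈ Finset.range p.length, basisEntry B i (p.mark i), x)}

theorem basisEntry_reindex {p q : ColoredPartition n} (σ : Equiv.Perm ℕ)
    (h : q.len = p.len ∘ σ) (B : Module.Basis p.Box F W) (i : ℕ) (j : ℤ) :
    basisEntry (B.reindex (ColoredPartition.boxEquiv σ h).symm) i j = basisEntry B (σ i) j := by
  have hi : q.len i = p.len (σ i) := congrFun h i
  unfold basisEntry
  by_cases hj : 1 ≤ j ∧ j ≤ p.len (σ i)
  · rw [dif_pos hj, dif_pos (by rw [hi]; exact hj), Module.Basis.reindex_apply]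
    rfl
  · rw [dif_neg hj, dif_neg (by rw [hi]; exact hj)]

theorem Psi_subset (V : ZMod n → Submodule F W) {p q : MarkedColoredPartition n}
    (h : p.RowEquiv q) : Psi V p ⊆ Psi V q := by
  have hl : p.length = q.length := ColoredPartition.length_eq h.shape
  obtain ⟨σ, h1, h2, h3⟩ := h
  rintro y ⟨x, hx, B, ⟨hB1, hB2⟩, hy⟩
  refine ⟨x, hx, B.reindex (ColoredPartition.boxEquiv σ h1).symm, ⟨fun b => ?_, fun b => ?_⟩, ?_⟩
  · rw [Module.Basis.reindex_apply, ← ColoredPartition.boxColor_boxEquiv σ h1 h2 b]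
    exact hB1 _
  · rw [basisEntry_reindex, Module.Basis.reindex_apply]
    exact hB2 _
  · have hsum : ∑ i ∈ Finset.range p.length, basisEntry B i (p.mark i) =
        ∑ i ∈ Finset.range q.length,
          basisEntry (B.reindex (ColoredPartition.boxEquiv σ h1).symm) i (q.mark i) := by
      symm
      refine Finset.sum_equiv σ (fun i => ?_) (fun i _ => ?_)
      · rw [Finset.mem_range, Finset.mem_range, ColoredPartition.lt_length_iff,
          ColoredPartition.lt_length_iff, h1]
        rfl
      · rw [basisEntry_reindex, h3]
        rfl
    rwa [← hsum]

/-- The orbit `Ψ` of a class of marked colored partitions. -/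
def PsiClass (V : ZMod n → Submodule F W) (c : MarkedColoredPartitionClass n) :
    Set (W × Module.End F W) :=
  Quotient.lift (Psi V) (fun _ _ h =>
    (Psi_subset V h).antisymm (Psi_subset V (Setoid.symm h))) c

/-- The marking `μ` of `(λ, ε)` is minimal: `(λ, ε)` has the signature of the colored vector space,
`μ ≥ 0`, and no marking `δ ≠ μ` with `0 ≤ δ ≤ μ` gives the same orbit as `μ`. -/
def IsMinimalMarking (V : ZMod n → Submodule F W) (p : MarkedColoredPartition n) : Prop :=
  p.signature = spaceSignature V ∧ 0 ≤ p.mark ∧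
    ∀ (δ : ℕ → ℤ) (h : ∀ i, δ i ≤ p.len i), 0 ≤ δ → δ ≤ p.mark →
      Psi V (p.withMark δ h) = Psi V p → δ = p.mark

/-- A characteristic colored bipartition: what remains of a minimally marked colored partition
after its unmarked nonzero rows are deleted, provided all marks in the remaining nonzero rows have
the same color. -/
def IsCharacteristicBipartition (V : ZMod n → Submodule F W)
    (c : MarkedColoredPartitionClass n) : Prop :=
  ∃ p : MarkedColoredPartition n, IsMinimalMarking V p ∧
    c = MarkedColoredPartitionClass.mk p.deleteUnmarked ∧
    ∀ i j, i < j → j < p.deleteUnmarked.length →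
      p.deleteUnmarked.markColor i = p.deleteUnmarked.markColor j

end Orbits

/-!
Choose a colored Jordan basis for `x`. If `v` is homogeneous, the part of `v` in each row can be
pushed to the right end of the row and used as a new top vector there; afterwards `v` is a sum of
basis vectors from distinct rows, that is, it is given by a marking. If the marks of rows `i` and
`j` have the same color and `0 < μ i ≤ μ j`, `λ j - μ j ≤ λ i - μ i`, then adding a vector of row
`i` to the top vector of row `j` turns `v_{j, μ j}` into `v_{i, μ i} + v_{j, μ j}`, so the mark of
row `i` can be erased. Hence in a minimal marking of a homogeneous vector, of any two marked rows
one is strictly larger both in `μ` and in `λ - μ`.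

Such a strict marking is determined by the pair `(v, x)`: which of the vectors `x ^ a v` lie in
which of the subspaces `range (x ^ l)` determines the lengths and marks of the marked rows, and the
color of `v` determines their colors. In particular no positive mark can be decreased, so that
strict markings are minimal. The dimensions of `range (x ^ l) ⊓ ker x ⊓ V m` determine all rows up
to order, and removing the marked rows leaves the unmarked ones.
-/

/-! ### Multiplicities -/

section ValueCount

variable {ι κ α : Type*}

/-- The multiplicity of `a` in the family `f`. Two sequences are rearrangements of each other if and
only if all multiplicities agree, which turns equalities of multisets of rows into arithmetic. -/
noncomputable def valueCount (f : ι → α) (a : α) : ℕ∞ := {i | f i = a}.encard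

theorem valueCount_eq_zero_iff {f : ι → α} {a : α} : valueCount f a = 0 ↔ ∀ i, f i ≠ a := by
  rw [valueCount, Set.encard_eq_zero, Set.eq_empty_iff_forall_notMem]
  rfl

theorem exists_eq_of_valueCount_le {f : ι → α} {g : κ → α} {i : ι}
    (h : valueCount f (f i) ≤ valueCount g (f i)) : ∃ k, g k = f i := by
  by_contra! hne
  have hzero : valueCount f (f i) = 0 :=
    nonpos_iff_eq_zero.mp (h.trans_eq (valueCount_eq_zero_iff.mpr hne))
  exact valueCount_eq_zero_iff.mp hzero i rfl

theorem valueCount_le_one_iff {f : ι → α} {a : α} :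
    valueCount f a ≤ 1 ↔ ∀ i j, f i = a → f j = a → i = j :=
  Set.encard_le_one_iff.trans <| forall₂_congr fun _ _ => Iff.rfl

theorem valueCount_eq_of_le_one {f : ι → α} {g : κ → α} {a : α} (hf : valueCount f a ≤ 1)
    (hg : valueCount g a ≤ 1) (h : (∃ i, f i = a) ↔ ∃ k, g k = a) :
    valueCount f a = valueCount g a := by
  have hzero : valueCount f a = 0 ↔ valueCount g a = 0 := by
    rw [valueCount_eq_zero_iff, valueCount_eq_zero_iff, ← not_exists, ← not_exists, h]
  rcases Order.le_one_iff.mp hf with hf | hf <;>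
    rcases Order.le_one_iff.mp hg with hg | hg <;> simp_all

theorem valueCount_comp_of_injective (f : ι → α) {e : κ → ι} (he : e.Injective) (a : α) :
    valueCount (f ∘ e) a = {i | i ∈ Set.range e ∧ f i = a}.encard := by
  rw [valueCount, ← he.encard_image]
  congr 1
  ext i
  constructor
  · rintro ⟨k, hk, rfl⟩
    exact ⟨⟨k, rfl⟩, hk⟩
  · rintro ⟨⟨k, rfl⟩, hk⟩
    exact ⟨k, hk, rfl⟩

theorem valueCount_comp_equiv (f : ι → α) (e : κ ≃ ι) (a : α) :
    valueCount (f ∘ e) a = valueCount f a := by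
  rw [valueCount_comp_of_injective f e.injective, e.range_eq_univ]
  simp only [Set.mem_univ, true_and]
  rfl

theorem valueCount_sumElim (f : ι → α) (g : κ → α) (a : α) :
    valueCount (Sum.elim f g) a = valueCount f a + valueCount g a := by
  have hunion : {s | Sum.elim f g s = a} = Sum.inl '' {i | f i = a} ∪ Sum.inr '' {k | g k = a} := by
    ext (i | k) <;> simp
  have hdisj : Disjoint (Sum.inl '' {i | f i = a}) (Sum.inr '' {k | g k = a}) :=
    Set.disjoint_image_inl_image_inr
  rw [valueCount, hunion, Set.encard_union_eq hdisj, Sum.inl_injective.encard_image,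
    Sum.inr_injective.encard_image]
  rfl

theorem exists_perm_eq_comp_iff [Countable ι] {f g : ι → α} :
    (∃ σ : Equiv.Perm ι, g = f ∘ σ) ↔ ∀ a, valueCount f a = valueCount g a := by
  constructor
  · rintro ⟨σ, rfl⟩ a
    exact (valueCount_comp_equiv f σ a).symm
  · intro h
    have hfiber : ∀ a, Nonempty ({i // g i = a} ≃ {i // f i = a}) := fun a =>
      Cardinal.eq.mp <|
        Cardinal.toENat_injOn Cardinal.mk_le_aleph0 Cardinal.mk_le_aleph0 (h a).symm
    let σ : Equiv.Perm ι := (Equiv.sigmaFiberEquiv g).symm.trans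
      ((Equiv.sigmaCongrRight fun a => (hfiber a).some).trans (Equiv.sigmaFiberEquiv f))
    exact ⟨σ, funext fun i => ((hfiber (g i)).some ⟨i, rfl⟩).2.symm⟩

end ValueCount

/-! ### Rows of colored partitions -/

namespace ColoredPartition

variable {n : ℕ}

/-- The length and the color of a row; the multiplicities of these pairs determine the class of the
colored partition. -/
def row (p : ColoredPartition n) (i : ℕ) : ℕ × ZMod n := (p.len i, p.color i)

theorem rowEquiv_iff_exists {p q : ColoredPartition n} :
    p.RowEquiv q ↔ ∃ σ : Equiv.Perm ℕ, q.row = p.row ∘ σ := by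
  refine exists_congr fun σ => ?_
  simp only [funext_iff, row, Function.comp_apply, Prod.mk.injEq, forall_and]

theorem rowEquiv_iff {p q : ColoredPartition n} :
    p.RowEquiv q ↔ ∀ t, valueCount p.row t = valueCount q.row t :=
  rowEquiv_iff_exists.trans exists_perm_eq_comp_iff

theorem valueCount_row_ne_top (p : ColoredPartition n) {t : ℕ × ZMod n} (ht : 0 < t.1) :
    valueCount p.row t ≠ ⊤ := by
  rw [valueCount, Set.encard_ne_top_iff]
  refine p.finite_support.subset ?_
  rintro i rfl
  exact ht

theorem infinite_empty_rows (p : ColoredPartition n) (c : ZMod n) :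
    {i | p.row i = (0, c)}.Infinite := by
  refine ((p.infinite_color c).sdiff p.finite_support).mono ?_
  rintro i ⟨hcolor, hlen⟩
  exact Prod.ext (Nat.eq_zero_of_not_pos hlen) hcolor

theorem rowEquiv_of_valueCount_eq {p q : ColoredPartition n}
    (h : ∀ t : ℕ × ZMod n, 0 < t.1 → valueCount p.row t = valueCount q.row t) :
    p.RowEquiv q := by
  refine rowEquiv_iff.mpr fun ⟨l, c⟩ => ?_
  rcases Nat.eq_zero_or_pos l with rfl | hl
  · rw [valueCount, valueCount, (p.infinite_empty_rows c).encard_eq,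
      (q.infinite_empty_rows c).encard_eq]
  · exact h _ hl

instance finite_box (p : ColoredPartition n) : Finite p.Box := by
  refine ((Set.finite_Iio p.length).prod (Set.finite_Iic (p.len 0))).subset ?_
  rintro ⟨i, j⟩ ⟨hj, hji⟩
  exact ⟨(p.lt_length_iff i).mpr (hj.trans hji), hji.trans (p.antitone_len i.zero_le)⟩

/-- The boxes of color `m` in a row of given length and color. A box is recorded by its distance to
the right end of the row, so that its color does not depend on the length. -/
abbrev RowBox (m : ZMod n) (r : ℕ × ZMod n) : Type := {k : Fin r.1 // r.2 + (k : ℕ) = m}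

/-- The boxes of color `m`, sorted by rows. -/
def boxesEquiv (p : ColoredPartition n) (m : ZMod n) :
    {b : p.Box // p.boxColor b = m} ≃ Σ i, RowBox m (p.row i) where
  toFun b := ⟨b.1.1.1, ⟨⟨p.len b.1.1.1 - b.1.1.2, by
    obtain ⟨⟨b, h1, h2⟩, -⟩ := b
    simp only [row]
    omega⟩, b.2⟩⟩
  invFun s := ⟨⟨(s.1, p.len s.1 - s.2.1), by
    have h := s.2.1.2
    simp only [row] at h
    dsimp only
    omega⟩, by
    have h := s.2.1.2
    have hcolor := s.2.2
    simp only [row] at h hcolor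
    simp only [boxColor, Nat.sub_sub_self h.le, hcolor]⟩
  left_inv := by
    rintro ⟨⟨⟨i, j⟩, -, hj⟩, -⟩
    simp only [Subtype.mk.injEq, Prod.mk.injEq, true_and]
    exact Nat.sub_sub_self hj
  right_inv := by
    rintro ⟨i, ⟨⟨k, hk⟩, -⟩⟩
    have : p.len i - (p.len i - k) = k := Nat.sub_sub_self hk.le
    simp [this]

theorem signature_eq_card (p : ColoredPartition n) (m : ZMod n) :
    p.signature m = Nat.card (Σ i, RowBox m (p.row i)) :=
  Nat.card_congr (p.boxesEquiv m)

instance finite_rowBoxes (p : ColoredPartition n) (m : ZMod n) :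
    Finite (Σ i, RowBox m (p.row i)) :=
  Finite.of_equiv _ (p.boxesEquiv m)

theorem signature_eq_add {p q r : ColoredPartition n} {e : ℕ ≃ ℕ ⊕ ℕ}
    (h : p.row = Sum.elim q.row r.row ∘ e) : p.signature = q.signature + r.signature := by
  funext m
  rw [Pi.add_apply, signature_eq_card, signature_eq_card, signature_eq_card, ← Nat.card_sum, h]
  exact Nat.card_congr <|
    (Equiv.sigmaCongrLeft (β := fun s => RowBox m (Sum.elim q.row r.row s)) e).trans
      (Equiv.sumSigmaDistrib _)

theorem exists_row_eq_comp {κ : Type*} [Countable κ] (R : κ → ℕ × ZMod n)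
    (hlen : {k | 0 < (R k).1}.Finite) (hcolor : ∀ m, {k | (R k).2 = m}.Infinite) :
    ∃ (p : ColoredPartition n) (e : ℕ ≃ κ), p.row = R ∘ e := by
  have : Infinite κ := Set.infinite_univ_iff.mp ((hcolor 0).mono (Set.subset_univ _))
  obtain ⟨_⟩ := nonempty_denumerable κ
  let e : ℕ ≃ κ := (Denumerable.eqv κ).symm
  have hbdd : ∃ N, ∀ i, N ≤ i → (R (e i)).1 = 0 := by
    obtain ⟨N, hN⟩ := (hlen.preimage e.injective.injOn).bddAbove
    refine ⟨N + 1, fun i hi => ?_⟩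
    by_contra hne
    exact absurd (hN (Nat.pos_of_ne_zero hne)) (by omega)
  obtain ⟨σ, hσ⟩ := exists_perm_antitone (fun i => (R (e i)).1) hbdd
  refine ⟨⟨fun i => (R (e (σ i))).1, fun i => (R (e (σ i))).2, hσ, ?_, fun m => ?_⟩,
    σ.trans e, rfl⟩
  · obtain ⟨N, hN⟩ := hbdd
    exact ⟨σ.symm N, by rw [Equiv.apply_symm_apply, hN N le_rfl]⟩
  · refine infinite_preimage_perm (c := fun i => (R (e i)).2) ?_ σ
    exact (hcolor m).preimage (by simp)

theorem exists_row_eq_sumElim [NeZero n] {ι : Type*} [Finite ι] (r : ι → ℕ × ZMod n) :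
    ∃ (p : ColoredPartition n) (e : ℕ ≃ ι ⊕ ℕ × ZMod n),
      p.row = Sum.elim r (fun s => (0, s.2)) ∘ e := by
  have : Countable ι := Finite.to_countable
  refine exists_row_eq_comp _ ?_ fun m => ?_
  · refine (Set.finite_range (Sum.inl : ι → ι ⊕ ℕ × ZMod n)).subset ?_
    rintro (i | s) h
    · exact ⟨i, rfl⟩
    · exact absurd h (lt_irrefl 0)
  · refine (Set.infinite_range_of_injective (f := fun k : ℕ =>
      (Sum.inr (k, m) : ι ⊕ ℕ × ZMod n)) fun a b hab => by simpa using hab).mono ?_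
    rintro _ ⟨k, rfl⟩
    rfl

theorem signature_eq_sum {p : ColoredPartition n} {ι κ : Type*} [Fintype ι]
    {r : ι → ℕ × ZMod n} {c : κ → ZMod n} {e : ℕ ≃ ι ⊕ κ}
    (h : p.row = Sum.elim r (fun k => (0, c k)) ∘ e) (m : ZMod n) :
    p.signature m = ∑ i, Nat.card (RowBox m (r i)) := by
  rw [signature_eq_card, h, ← Nat.card_sigma]
  have hempty : IsEmpty (Σ k, RowBox m (Sum.elim r (fun k => (0, c k)) (Sum.inr k))) :=
    ⟨fun s => Fin.elim0 s.2.1⟩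
  exact Nat.card_congr <|
    (Equiv.sigmaCongrLeft (β := fun s => RowBox m (Sum.elim r (fun k => (0, c k)) s)) e).trans <|
      (Equiv.sumSigmaDistrib _).trans (Equiv.sumEmpty _ _)

theorem exists_signature_eq [NeZero n] (f : ZMod n → ℕ) :
    ∃ p : ColoredPartition n, p.signature = f := by
  obtain ⟨p, e, he⟩ := exists_row_eq_sumElim fun s : Σ m, Fin (f m) => ((1 : ℕ), s.1)
  refine ⟨p, funext fun m => ?_⟩
  have hcard (c : ZMod n) : Nat.card (RowBox m (1, c)) = if c = m then 1 else 0 := by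
    split_ifs with hc <;> simp [RowBox, hc]
  simp only [signature_eq_sum he, hcard, Fintype.sum_sigma]
  simp [apply_ite Finset.card]

theorem exists_sigma_equiv_box {p : ColoredPartition n} {ι κ : Type*}
    {r : ι → ℕ × ZMod n} {c : κ → ZMod n} {e : ℕ ≃ ι ⊕ κ}
    (h : p.row = Sum.elim r (fun k => (0, c k)) ∘ e) :
    ∃ E : (Σ i, Fin (r i).1) ≃ p.Box, ∀ s, e (E s).1.1 = Sum.inl s.1 ∧
      p.len (E s).1.1 - (E s).1.2 = s.2 := by
  have hlen (i : ι) : p.len (e.symm (Sum.inl i)) = (r i).1 := by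
    simpa [row] using congrArg Prod.fst (congrFun h (e.symm (Sum.inl i)))
  let f (s : Σ i, Fin (r i).1) : p.Box := ⟨(e.symm (Sum.inl s.1), (r s.1).1 - s.2), by
    have := s.2.2
    have := hlen s.1
    dsimp only
    omega⟩
  have hf (s) : e (f s).1.1 = Sum.inl s.1 ∧ p.len (f s).1.1 - (f s).1.2 = s.2 := by
    have := s.2.2
    refine ⟨e.apply_symm_apply _, ?_⟩
    dsimp only [f]
    rw [hlen]
    omega
  refine ⟨Equiv.ofBijective f ⟨fun s s' hs => ?_, fun b => ?_⟩, hf⟩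
  · have h1 := hf s
    rw [hs, (hf s').1, (hf s').2, Sum.inl.injEq] at h1
    obtain ⟨i, j⟩ := s
    obtain ⟨i', j'⟩ := s'
    obtain ⟨rfl, hj⟩ := h1
    exact congrArg (Sigma.mk i') (Fin.ext hj.symm)
  · have := b.2
    rcases hi : e b.1.1 with i | k
    · have hrow : e.symm (Sum.inl i) = b.1.1 := e.symm_apply_eq.mpr hi.symm
      have := hrow ▸ hlen i
      refine ⟨⟨i, p.len b.1.1 - b.1.2, by omega⟩, Subtype.ext (Prod.ext hrow ?_)⟩
      dsimp only [f]
      omega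
    · have : p.len b.1.1 = 0 := by
        simpa [row, hi] using congrArg Prod.fst (congrFun h b.1.1)
      omega

end ColoredPartition

/-! ### Rows of marked colored partitions -/

/-- The colored partition `(λ, ε)` with the zero marking. -/
def ColoredPartition.unmarked {n : ℕ} (p : ColoredPartition n) : MarkedColoredPartition n :=
  ⟨p, 0, fun _ => by simp⟩

namespace MarkedColoredPartition

variable {n : ℕ}

/-- The length, the color and the mark of a row, in the form `((len, color), mark)`; the
multiplicities of these triples determine the class of the marked colored partition. -/
def row (p : MarkedColoredPartition n) (i : ℕ) : (ℕ × ZMod n) × ℤ :=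
  (p.toColoredPartition.row i, p.mark i)

theorem rowEquiv_iff_exists {p q : MarkedColoredPartition n} :
    p.RowEquiv q ↔ ∃ σ : Equiv.Perm ℕ, q.row = p.row ∘ σ := by
  refine exists_congr fun σ => ?_
  simp only [funext_iff, row, ColoredPartition.row, Function.comp_apply, Prod.mk.injEq, forall_and,
    and_assoc]

theorem rowEquiv_iff {p q : MarkedColoredPartition n} :
    p.RowEquiv q ↔ ∀ t, valueCount p.row t = valueCount q.row t :=
  rowEquiv_iff_exists.trans exists_perm_eq_comp_iff

theorem exists_row_union (p q : MarkedColoredPartition n) :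
    ∃ e : ℕ ≃ ℕ ⊕ ℕ, (p.union q).row = Sum.elim q.row p.row ∘ e := by
  let σ := (exists_sort_interlace p q).choose
  refine ⟨σ.trans Equiv.natSumNatEquivNat.symm, funext fun i => ?_⟩
  change ((interlace p.len q.len (σ i), interlace p.color q.color (σ i)),
    interlace p.mark q.mark (σ i)) = Sum.elim q.row p.row (Equiv.natSumNatEquivNat.symm (σ i))
  simp only [interlace_eq, Function.comp_apply]
  rcases Equiv.natSumNatEquivNat.symm (σ i) with k | k <;> rfl

theorem valueCount_row_union (p q : MarkedColoredPartition n) (t : (ℕ × ZMod n) × ℤ) :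
    valueCount (p.union q).row t = valueCount p.row t + valueCount q.row t := by
  obtain ⟨e, he⟩ := exists_row_union p q
  rw [he, valueCount_comp_equiv, valueCount_sumElim, add_comm]

theorem exists_shape_union (p q : MarkedColoredPartition n) :
    ∃ e : ℕ ≃ ℕ ⊕ ℕ, (p.union q).toColoredPartition.row =
      Sum.elim q.toColoredPartition.row p.toColoredPartition.row ∘ e := by
  obtain ⟨e, he⟩ := exists_row_union p q
  refine ⟨e, funext fun i => (congrArg Prod.fst (congrFun he i)).trans ?_⟩
  rw [Function.comp_apply, Function.comp_apply]
  rcases e i with k | k <;> rfl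

theorem valueCount_shape_union (p q : MarkedColoredPartition n) (t : ℕ × ZMod n) :
    valueCount (p.union q).toColoredPartition.row t =
      valueCount p.toColoredPartition.row t + valueCount q.toColoredPartition.row t := by
  obtain ⟨e, he⟩ := exists_shape_union p q
  rw [he, valueCount_comp_equiv, valueCount_sumElim, add_comm]

theorem signature_union (p q : MarkedColoredPartition n) :
    (p.union q).signature = p.signature + q.signature := by
  obtain ⟨e, he⟩ := exists_shape_union p q
  rw [ColoredPartition.signature_eq_add he, add_comm]

theorem valueCount_row_unmarked (d : ColoredPartition n) {t : (ℕ × ZMod n) × ℤ} (ht : t.2 ≠ 0) :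
    valueCount d.unmarked.row t = 0 := by
  rw [valueCount_eq_zero_iff]
  rintro i rfl
  exact ht rfl

theorem valueCount_row_union_unmarked (p : MarkedColoredPartition n) (d : ColoredPartition n)
    {t : (ℕ × ZMod n) × ℤ} (ht : t.2 ≠ 0) :
    valueCount (p.union d.unmarked).row t = valueCount p.row t := by
  rw [valueCount_row_union, valueCount_row_unmarked d ht, add_zero]

theorem union_unmarked_mark_nonneg {p : MarkedColoredPartition n} (h0 : 0 ≤ p.mark)
    (d : ColoredPartition n) : 0 ≤ (p.union d.unmarked).mark := by
  intro i
  obtain ⟨e, he⟩ := exists_row_union p d.unmarked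
  have hmark := congrArg Prod.snd (congrFun he i)
  rw [Function.comp_apply] at hmark
  rcases h : e i with k | k <;> rw [h] at hmark
  · exact hmark.ge
  · exact (h0 k).trans hmark.ge

theorem valueCount_row_deleteRows (p : MarkedColoredPartition n) {S : Set ℕ} (hS : S.Finite)
    (t : (ℕ × ZMod n) × ℤ) :
    valueCount (p.deleteRows S hS).row t = {i | i ∉ S ∧ p.row i = t}.encard := by
  change valueCount (p.row ∘ Nat.nth (· ∉ S)) t = _
  rw [valueCount_comp_of_injective _ (Nat.nth_strictMono hS.infinite_compl).injective,
    Nat.range_nth_of_infinite hS.infinite_compl]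
  rfl

theorem valueCount_row_deleteRows_of_notMem (p : MarkedColoredPartition n) {S : Set ℕ}
    (hS : S.Finite) {t : (ℕ × ZMod n) × ℤ} (h : ∀ i, p.row i = t → i ∉ S) :
    valueCount (p.deleteRows S hS).row t = valueCount p.row t := by
  rw [valueCount_row_deleteRows, valueCount]
  congr 1
  ext i
  exact ⟨And.right, fun hi => ⟨h i hi, hi⟩⟩

theorem mark_eq_zero_of_len_eq_zero {p : MarkedColoredPartition n} (h0 : 0 ≤ p.mark) {i : ℕ}
    (hi : p.len i = 0) : p.mark i = 0 := by
  have := p.mark_le i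
  exact le_antisymm (by omega) (h0 i)

theorem len_pos_of_mark_pos (p : MarkedColoredPartition n) {i : ℕ} (hi : 0 < p.mark i) :
    0 < p.len i := by
  have := p.mark_le i
  omega

theorem valueCount_empty_row {p : MarkedColoredPartition n} (h0 : 0 ≤ p.mark) (c : ZMod n) :
    valueCount p.row ((0, c), 0) = ⊤ := by
  rw [valueCount, Set.encard_eq_top_iff]
  refine (p.infinite_empty_rows c).mono fun i hi => ?_
  exact Prod.ext hi (mark_eq_zero_of_len_eq_zero h0 (congrArg Prod.fst hi))

/-! ### Fully marked partitions -/

/-- Every nonzero row carries a nonzero mark. Up to row equivalence, adding unmarked rows and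
deleting them again are inverse to each other on such partitions. -/
def FullyMarked (p : MarkedColoredPartition n) : Prop := ∀ i, 0 < p.len i → p.mark i ≠ 0

theorem FullyMarked.valueCount_row_eq_zero {p : MarkedColoredPartition n} (hp : p.FullyMarked)
    {t : ℕ × ZMod n} (ht : 0 < t.1) : valueCount p.row (t, 0) = 0 := by
  rw [valueCount_eq_zero_iff]
  intro i hi
  obtain ⟨rfl, hmark⟩ := Prod.mk.inj hi
  exact hp i ht hmark

theorem valueCount_row_eq_zero_of_neg {p : MarkedColoredPartition n} (h0 : 0 ≤ p.mark)
    {t : (ℕ × ZMod n) × ℤ} (ht : t.2 < 0) : valueCount p.row t = 0 := by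
  rw [valueCount_eq_zero_iff]
  rintro i rfl
  exact ht.not_ge (h0 i)

theorem rowEquiv_of_fullyMarked {p q : MarkedColoredPartition n} (hp0 : 0 ≤ p.mark)
    (hq0 : 0 ≤ q.mark) (hp : p.FullyMarked) (hq : q.FullyMarked)
    (h : ∀ t : (ℕ × ZMod n) × ℤ, 0 < t.2 → valueCount p.row t = valueCount q.row t) :
    p.RowEquiv q := by
  refine rowEquiv_iff.mpr fun ⟨⟨l, c⟩, m⟩ => ?_
  rcases lt_trichotomy m 0 with hm | rfl | hm
  · rw [valueCount_row_eq_zero_of_neg hp0 hm, valueCount_row_eq_zero_of_neg hq0 hm]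
  · rcases Nat.eq_zero_or_pos l with rfl | hl
    · rw [valueCount_empty_row hp0, valueCount_empty_row hq0]
    · rw [hp.valueCount_row_eq_zero hl, hq.valueCount_row_eq_zero hl]
  · exact h _ hm

theorem fullyMarked_deleteUnmarked (p : MarkedColoredPartition n) : p.deleteUnmarked.FullyMarked :=
  fun k hlen hmark => Nat.nth_mem_of_infinite (p := (· ∉ {i | 0 < p.len i ∧ p.mark i = 0}))
    (p.finite_support.subset fun _ hi => hi.1).infinite_compl k ⟨hlen, hmark⟩

theorem deleteUnmarked_mark_nonneg {p : MarkedColoredPartition n} (h0 : 0 ≤ p.mark) :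
    0 ≤ p.deleteUnmarked.mark := fun _ => h0 _

theorem valueCount_row_deleteUnmarked (p : MarkedColoredPartition n) {t : (ℕ × ZMod n) × ℤ}
    (ht : t.2 ≠ 0) : valueCount p.deleteUnmarked.row t = valueCount p.row t := by
  refine valueCount_row_deleteRows_of_notMem p _ ?_
  rintro i rfl hi
  exact ht hi.2

theorem rowEquiv_deleteUnmarked_union {p : MarkedColoredPartition n} (h0 : 0 ≤ p.mark)
    (hp : p.FullyMarked) (d : ColoredPartition n) :
    p.RowEquiv (p.union d.unmarked).deleteUnmarked :=
  rowEquiv_of_fullyMarked h0 (deleteUnmarked_mark_nonneg (union_unmarked_mark_nonneg h0 d)) hp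
    (fullyMarked_deleteUnmarked _) fun _ ht => by
      rw [valueCount_row_deleteUnmarked _ ht.ne', valueCount_row_union_unmarked _ _ ht.ne']

/-- The colored partition formed by the rows that are empty or unmarked. -/
noncomputable def unmarkedPart (p : MarkedColoredPartition n) : ColoredPartition n :=
  (p.deleteRows {i | 0 < p.len i ∧ p.mark i ≠ 0}
    (p.finite_support.subset fun _ hi => hi.1)).toColoredPartition

theorem valueCount_row_unmarkedPart (p : MarkedColoredPartition n) {t : ℕ × ZMod n}
    (ht : 0 < t.1) : valueCount p.unmarkedPart.unmarked.row (t, 0) = valueCount p.row (t, 0) := by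
  have hfin : {i | 0 < p.len i ∧ p.mark i ≠ 0}.Finite := p.finite_support.subset fun _ hi => hi.1
  rw [← valueCount_row_deleteRows_of_notMem p hfin, valueCount, valueCount]
  · congr 1
    ext k
    simp only [Set.mem_ofPred_eq, row, Prod.mk.injEq]
    refine and_congr_right fun hk => iff_of_true rfl ?_
    by_contra hmark
    refine Nat.nth_mem_of_infinite (p := (· ∉ {i | 0 < p.len i ∧ p.mark i ≠ 0}))
      hfin.infinite_compl k ⟨?_, hmark⟩
    rw [← hk] at ht
    exact ht
  · exact fun i hi hmem => hmem.2 (congrArg Prod.snd hi)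

theorem union_unmarkedPart_rowEquiv {p : MarkedColoredPartition n} (h0 : 0 ≤ p.mark) :
    (p.deleteUnmarked.union p.unmarkedPart.unmarked).RowEquiv p := by
  refine rowEquiv_iff.mpr fun ⟨⟨l, c⟩, m⟩ => ?_
  rcases eq_or_ne m 0 with rfl | hm
  · rw [valueCount_row_union]
    rcases Nat.eq_zero_or_pos l with rfl | hl
    · rw [valueCount_empty_row h0, valueCount_empty_row (deleteUnmarked_mark_nonneg h0), top_add]
    · rw [p.fullyMarked_deleteUnmarked.valueCount_row_eq_zero hl, zero_add,
        valueCount_row_unmarkedPart p hl]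
  · rw [valueCount_row_union_unmarked _ _ hm, valueCount_row_deleteUnmarked p hm]

theorem signature_deleteUnmarked_add {p : MarkedColoredPartition n} (h0 : 0 ≤ p.mark) :
    p.deleteUnmarked.signature + p.unmarkedPart.signature = p.signature := by
  rw [← ColoredPartition.signature_eq (union_unmarkedPart_rowEquiv h0).shape, signature_union]
  rfl

end MarkedColoredPartition

/-! ### Strictly decreasing marks -/

namespace MarkedColoredPartition

variable {n : ℕ}

/-- All positive marks have the same color. This says that the vector `∑ i, v_{i, μ i}` attached to
the marking is homogeneous. -/
def MonochromaticMarks (p : MarkedColoredPartition n) : Prop :=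
  ∀ i j, 0 < p.mark i → 0 < p.mark j → p.markColor i = p.markColor j

/-- The marks are nonnegative and monochromatic, and of any two rows with positive marks one is
strictly larger both in its mark and in its number of boxes beyond the mark. In contrast to the
conditions on a characteristic colored bipartition, this makes sense in the presence of unmarked
rows and does not depend on the order of the rows. -/
structure StrictMarks (p : MarkedColoredPartition n) : Prop where
  nonneg : 0 ≤ p.mark
  monochromatic : p.MonochromaticMarks
  comparable : ∀ i j, i ≠ j → 0 < p.mark i → 0 < p.mark j →
    p.mark j < p.mark i ∧ p.len j - p.mark j < p.len i - p.mark i ∨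
      p.mark i < p.mark j ∧ p.len i - p.mark i < p.len j - p.mark j

theorem markColor_congr {p q : MarkedColoredPartition n} {i j : ℕ} (h : p.row i = q.row j) :
    p.markColor i = q.markColor j := by
  simp only [row, ColoredPartition.row, Prod.mk.injEq] at h
  rw [markColor, markColor, h.1.1, h.1.2, h.2]

theorem MonochromaticMarks.of_lt {p : MarkedColoredPartition n}
    (h : ∀ i j, i < j → j < p.length → p.markColor i = p.markColor j) :
    p.MonochromaticMarks := by
  have hlt (i : ℕ) (hi : 0 < p.mark i) : i < p.length :=
    (p.lt_length_iff i).mpr (p.len_pos_of_mark_pos hi)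
  intro i j hi hj
  rcases lt_trichotomy i j with hij | rfl | hij
  · exact h i j hij (hlt j hj)
  · rfl
  · exact (h j i hij (hlt i hi)).symm

theorem MonochromaticMarks.of_deleteUnmarked {p : MarkedColoredPartition n}
    (h : p.deleteUnmarked.MonochromaticMarks) : p.MonochromaticMarks := by
  have hrow (i : ℕ) (hi : 0 < p.mark i) : ∃ k, p.deleteUnmarked.row k = p.row i :=
    exists_eq_of_valueCount_le (valueCount_row_deleteUnmarked p hi.ne').ge
  intro i j hi hj
  obtain ⟨k, hk⟩ := hrow i hi
  obtain ⟨l, hl⟩ := hrow j hj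
  rw [← markColor_congr hk, ← markColor_congr hl]
  exact h k l (hi.trans_eq (congrArg Prod.snd hk).symm) (hj.trans_eq (congrArg Prod.snd hl).symm)

theorem StrictMarks.valueCount_row_le_one {p : MarkedColoredPartition n} (hp : p.StrictMarks)
    {t : (ℕ × ZMod n) × ℤ} (ht : 0 < t.2) : valueCount p.row t ≤ 1 := by
  refine valueCount_le_one_iff.mpr fun i j hi hj => ?_
  have hmark : p.mark i = p.mark j := congrArg Prod.snd (hi.trans hj.symm)
  have hpos : 0 < p.mark i := ht.trans_eq (congrArg Prod.snd hi).symm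
  by_contra hij
  have := hp.comparable i j hij hpos (hmark ▸ hpos)
  omega

theorem StrictMarks.of_valueCount_le {p q : MarkedColoredPartition n} (hp : p.StrictMarks)
    (h : ∀ t : (ℕ × ZMod n) × ℤ, t.2 ≠ 0 → valueCount q.row t ≤ valueCount p.row t) :
    q.StrictMarks := by
  have hrow (i : ℕ) (hi : q.mark i ≠ 0) : ∃ k, p.row k = q.row i :=
    exists_eq_of_valueCount_le (h (q.row i) hi)
  refine ⟨fun i => ?_, fun i j hi hj => ?_, fun i j hij hi hj => ?_⟩
  · rcases eq_or_ne (q.mark i) 0 with hi | hi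
    · exact hi.ge
    · obtain ⟨k, hk⟩ := hrow i hi
      exact (hp.nonneg k).trans_eq (congrArg Prod.snd hk)
  all_goals
    obtain ⟨k, hk⟩ := hrow i hi.ne'
    obtain ⟨l, hl⟩ := hrow j hj.ne'
    have hmk : p.mark k = q.mark i := congrArg Prod.snd hk
    have hml : p.mark l = q.mark j := congrArg Prod.snd hl
  · rw [← markColor_congr hk, ← markColor_congr hl]
    exact hp.monochromatic k l (hmk ▸ hi) (hml ▸ hj)
  · have hkl : k ≠ l := by
      rintro rfl
      exact hij <| valueCount_le_one_iff.mp ((h _ hi.ne').trans (hp.valueCount_row_le_one hi)) i j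
        rfl (hl.symm.trans hk)
    have hlk : p.len k = q.len i := congrArg (fun t => t.1.1) hk
    have hll : p.len l = q.len j := congrArg (fun t => t.1.1) hl
    rw [← hmk, ← hml, ← hlk, ← hll]
    exact hp.comparable k l hkl (hmk ▸ hi) (hml ▸ hj)

theorem StrictMarks.of_rowEquiv {p q : MarkedColoredPartition n} (hp : p.StrictMarks)
    (h : p.RowEquiv q) : q.StrictMarks :=
  hp.of_valueCount_le fun t _ => (rowEquiv_iff.mp h t).ge

theorem StrictMarks.deleteUnmarked {p : MarkedColoredPartition n} (hp : p.StrictMarks) :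
    p.deleteUnmarked.StrictMarks :=
  hp.of_valueCount_le fun _ ht => (valueCount_row_deleteUnmarked p ht).le

theorem StrictMarks.union_unmarked {p : MarkedColoredPartition n} (hp : p.StrictMarks)
    (d : ColoredPartition n) : (p.union d.unmarked).StrictMarks :=
  hp.of_valueCount_le fun _ ht => (valueCount_row_union_unmarked p d ht).le

theorem FullyMarked.of_rowEquiv {p q : MarkedColoredPartition n} (hp : p.FullyMarked)
    (h : p.RowEquiv q) : q.FullyMarked := by
  obtain ⟨σ, hlen, -, hmark⟩ := h
  intro i hi
  rw [hlen] at hi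
  rw [hmark]
  exact hp _ hi

theorem strictMarks_and_fullyMarked_iff (p : MarkedColoredPartition n) :
    p.StrictMarks ∧ p.FullyMarked ↔
      (∀ i, i < p.length → 0 < p.mark i) ∧ (∀ i, p.length ≤ i → p.mark i = 0) ∧
        ∀ i j, i < j → j < p.length → p.markColor i = p.markColor j ∧
          p.mark j < p.mark i ∧ p.len j - p.mark j < p.len i - p.mark i := by
  simp only [← not_lt (b := p.length), p.lt_length_iff, not_lt, nonpos_iff_eq_zero]
  constructor
  · rintro ⟨⟨h0, hcolor, hcomp⟩, hfull⟩
    have hpos (i : ℕ) (hi : 0 < p.len i) : 0 < p.mark i := (h0 i).lt_of_ne' (hfull i hi)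
    refine ⟨hpos, fun i hi => mark_eq_zero_of_len_eq_zero h0 hi, fun i j hij hj => ?_⟩
    have hle := p.antitone_len hij.le
    have hi := hpos i (hj.trans_le hle)
    have := hcomp i j hij.ne hi (hpos j hj)
    exact ⟨hcolor i j hi (hpos j hj), by omega⟩
  · rintro ⟨hpos, hzero, hlt⟩
    refine ⟨⟨fun i => ?_, .of_lt fun i j hij hj => ?_, fun i j hij hi hj => ?_⟩,
      fun i hi => (hpos i hi).ne'⟩
    · rcases Nat.eq_zero_or_pos (p.len i) with hi | hi
      · exact (hzero i hi).ge
      · exact (hpos i hi).le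
    · exact (hlt i j hij ((p.lt_length_iff j).mp hj)).1
    · rcases hij.lt_or_gt with hij | hij
      · exact Or.inl (hlt i j hij (p.len_pos_of_mark_pos hj)).2
      · exact Or.inr (hlt j i hij (p.len_pos_of_mark_pos hi)).2

end MarkedColoredPartition

/-! ### Colored Jordan bases -/

namespace ColoredPartition

variable {n : ℕ}

/-- The color of column `j` of row `i`, extended to all integers `j`. -/
def entryColor (p : ColoredPartition n) (i : ℕ) (j : ℤ) : ZMod n :=
  p.color i + ((p.len i - j : ℤ) : ZMod n)

theorem entryColor_box (p : ColoredPartition n) (b : p.Box) :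
    p.entryColor b.1.1 b.1.2 = p.boxColor b := by
  rw [entryColor, boxColor, Nat.cast_sub b.2.2]
  push_cast
  rfl

theorem entryColor_len (p : ColoredPartition n) (i : ℕ) :
    p.entryColor i (p.len i) = p.color i := by
  simp [entryColor]

theorem entryColor_add (p : ColoredPartition n) (i : ℕ) (j k : ℤ) :
    p.entryColor i (j + k) = p.entryColor i j - k := by
  simp only [entryColor, Int.cast_sub, Int.cast_add, Int.cast_natCast]
  ring

theorem exists_box (p : ColoredPartition n) {i : ℕ} {j : ℤ} (h1 : 1 ≤ j) (h2 : j ≤ p.len i) :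
    ∃ b : p.Box, b.1.1 = i ∧ (b.1.2 : ℤ) = j :=
  ⟨⟨(i, j.toNat), by dsimp only; omega, by dsimp only; omega⟩, rfl, by dsimp only; omega⟩

theorem ncard_long_rows (p : ColoredPartition n) (l : ℕ) (c : ZMod n) :
    ({i | l < p.len i ∧ p.entryColor i 1 = c + l}.ncard : ℕ∞) =
      valueCount p.row (l + 1, c) + {i | l + 1 < p.len i ∧ p.entryColor i 1 = c + l}.ncard := by
  have hfin (k : ℕ) : {i | k < p.len i ∧ p.entryColor i 1 = c + l}.Finite :=
    p.finite_support.subset fun i hi => (Nat.zero_le k).trans_lt hi.1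
  rw [(hfin _).cast_ncard_eq, (hfin _).cast_ncard_eq, valueCount, ← Set.encard_union_eq]
  · congr 1
    ext i
    have hcolor (h : p.len i = l + 1) : p.entryColor i 1 = c + l ↔ p.color i = c := by
      simp [entryColor, h]
    simp only [Set.mem_ofPred_eq, Set.mem_union, row, Prod.mk.injEq]
    rcases eq_or_ne (p.len i) (l + 1) with h | h
    · simp [h, hcolor h]
    · simp [h, lt_iff_le_and_ne, h.symm]
  · rw [Set.disjoint_left]
    rintro i hi ⟨hlt, -⟩
    exact hlt.ne' (congrArg Prod.fst hi)

end ColoredPartition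

section BasisEntry

variable {n : ℕ} {F W : Type*} [Field F] [AddCommGroup W] [Module F W]
  {p : ColoredPartition n} (B : Module.Basis p.Box F W)

theorem basisEntry_box (b : p.Box) : basisEntry B b.1.1 b.1.2 = B b := by
  have := b.2
  rw [basisEntry, dif_pos (by omega)]
  congr 1

theorem basisEntry_eq_zero {i : ℕ} {j : ℤ} (h : ¬ (1 ≤ j ∧ j ≤ p.len i)) : basisEntry B i j = 0 :=
  dif_neg h

theorem basisEntry_of_nonpos (i : ℕ) {j : ℤ} (h : j ≤ 0) : basisEntry B i j = 0 :=
  basisEntry_eq_zero B (by omega)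

theorem basisEntry_map (k : W ≃ₗ[F] W) (i : ℕ) (j : ℤ) :
    basisEntry (B.map k) i j = k (basisEntry B i j) := by
  unfold basisEntry
  split
  · rfl
  · rw [map_zero]

/-- The coordinate functional dual to `basisEntry B i j`, extended by `0`. -/
noncomputable def basisCoord (i : ℕ) (j : ℤ) : W →ₗ[F] F :=
  if h : 1 ≤ j ∧ j ≤ p.len i then
    B.coord ⟨(i, j.toNat), by dsimp only; omega, by dsimp only; omega⟩
  else 0

theorem basisCoord_box (b : p.Box) (w : W) : basisCoord B b.1.1 b.1.2 w = B.repr w b := by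
  have := b.2
  rw [basisCoord, dif_pos (by omega), Module.Basis.coord_apply]
  congr 1

theorem basisCoord_eq_zero {i : ℕ} {j : ℤ} (h : ¬ (1 ≤ j ∧ j ≤ p.len i)) : basisCoord B i j = 0 :=
  dif_neg h

theorem basisCoord_basisEntry (i i' : ℕ) (j j' : ℤ) :
    basisCoord B i j (basisEntry B i' j') =
      if i = i' ∧ j = j' ∧ 1 ≤ j ∧ j ≤ p.len i then 1 else 0 := by
  by_cases h : 1 ≤ j ∧ j ≤ p.len i
  · by_cases h' : 1 ≤ j' ∧ j' ≤ p.len i'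
    · obtain ⟨b, rfl, rfl⟩ := p.exists_box h.1 h.2
      obtain ⟨b', rfl, rfl⟩ := p.exists_box h'.1 h'.2
      rw [basisCoord_box, basisEntry_box, Module.Basis.repr_self, Finsupp.single_apply]
      refine if_congr ?_ rfl rfl
      rw [Subtype.ext_iff, Prod.ext_iff]
      omega
    · rw [basisEntry_eq_zero B h', map_zero, if_neg]
      rintro ⟨rfl, rfl, hj⟩
      exact h' hj
  · rw [basisCoord_eq_zero B h, LinearMap.zero_apply, if_neg]
    exact fun h' => h h'.2.2

end BasisEntry

section Span

variable {F W ι κ : Type*} [Field F] [AddCommGroup W] [Module F W]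

theorem span_basis_image_inter (B : Module.Basis κ F W) (S T : Set κ) :
    Submodule.span F (B '' (S ∩ T)) = Submodule.span F (B '' S) ⊓ Submodule.span F (B '' T) := by
  ext w
  simp only [Submodule.mem_inf, Module.Basis.mem_span_image, Set.subset_inter_iff]

theorem finrank_span_basis_image [Finite κ] (B : Module.Basis κ F W) (S : Set κ) :
    Module.finrank F (Submodule.span F (B '' S)) = S.ncard := by
  have := Fintype.ofFinite S
  rw [Set.image_eq_range, finrank_span_eq_card (b := fun s : S => B s)
    (B.linearIndependent.comp _ Subtype.val_injective), Set.ncard_eq_toFinset_card',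
    Set.toFinset_card]

theorem span_basis_image_fiber_eq {V : ι → Submodule F W} (hV : iSupIndep V)
    (B : Module.Basis κ F W) {c : κ → ι} (hB : ∀ b, B b ∈ V (c b)) (m : ι) :
    Submodule.span F (B '' {b | c b = m}) = V m := by
  have htop : ⨆ m, Submodule.span F (B '' {b | c b = m}) = ⊤ := by
    rw [eq_top_iff, ← B.span_eq, Submodule.span_le]
    rintro _ ⟨b, rfl⟩
    exact Submodule.mem_iSup_of_mem (c b) (Submodule.subset_span ⟨b, rfl, rfl⟩)
  refine congrFun ((hV.le_iff_eq_of_iSup_eq_top htop).mp fun m => Submodule.span_le.mpr ?_) m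
  rintro _ ⟨b, rfl, rfl⟩
  exact hB b

end Span

namespace IsColoredJordanBasis

variable {n : ℕ} {F W : Type*} [Field F] [AddCommGroup W] [Module F W] {p : ColoredPartition n}
  {V : ZMod n → Submodule F W} {x : Module.End F W} {B : Module.Basis p.Box F W}

theorem pow_apply_basisEntry (hB : IsColoredJordanBasis V x B) (i : ℕ) {j : ℤ}
    (hj : j ≤ p.len i) (k : ℕ) : (x ^ k) (basisEntry B i j) = basisEntry B i (j - k) := by
  induction k with
  | zero => simp
  | succ k ih =>
    rw [pow_succ', Module.End.mul_apply, ih, Nat.cast_succ, ← sub_sub]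
    by_cases h : 1 ≤ j - k
    · obtain ⟨b, rfl, hb⟩ := p.exists_box h (by omega : j - k ≤ p.len i)
      rw [← hb, basisEntry_box, hB.2]
    · rw [basisEntry_of_nonpos B i (by omega), basisEntry_of_nonpos B i (by omega), map_zero]

theorem basisEntry_mem (hB : IsColoredJordanBasis V x B) (i : ℕ) (j : ℤ) :
    basisEntry B i j ∈ V (p.entryColor i j) := by
  by_cases h : 1 ≤ j ∧ j ≤ p.len i
  · obtain ⟨b, rfl, rfl⟩ := p.exists_box h.1 h.2
    rw [basisEntry_box, p.entryColor_box]
    exact hB.1 b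
  · rw [basisEntry_eq_zero B h]
    exact zero_mem _

theorem basisCoord_pow (hB : IsColoredJordanBasis V x B) (i : ℕ) {j : ℤ} (hj : 1 ≤ j) (k : ℕ)
    (w : W) : basisCoord B i j ((x ^ k) w) = basisCoord B i (j + k) w := by
  suffices h : basisCoord B i j ∘ₗ (x ^ k) = basisCoord B i (j + k) from LinearMap.congr_fun h w
  refine B.ext fun b => ?_
  have := b.2.2
  rw [← basisEntry_box, LinearMap.comp_apply, hB.pow_apply_basisEntry _ (by omega),
    basisCoord_basisEntry, basisCoord_basisEntry]
  refine if_congr ?_ rfl rfl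
  constructor
  all_goals
    rintro ⟨rfl, h⟩
    omega

theorem range_pow_eq_span (hB : IsColoredJordanBasis V x B) (l : ℕ) :
    LinearMap.range (x ^ l) = Submodule.span F (B '' {b | b.1.2 + l ≤ p.len b.1.1}) := by
  apply le_antisymm
  · rw [LinearMap.range_eq_map, ← B.span_eq, Submodule.map_span, Submodule.span_le]
    rintro _ ⟨_, ⟨b, rfl⟩, rfl⟩
    have := b.2.2
    rw [← basisEntry_box, hB.pow_apply_basisEntry _ (by omega)]
    by_cases hl : 1 ≤ (b.1.2 : ℤ) - l
    · obtain ⟨c, hrow, hcol⟩ := p.exists_box hl (by omega : _ ≤ (p.len b.1.1 : ℤ))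
      rw [← hcol, ← hrow, basisEntry_box]
      refine Submodule.subset_span ⟨c, ?_, rfl⟩
      rw [Set.mem_ofPred_eq, hrow]
      omega
    · rw [basisEntry_of_nonpos B _ (by omega)]
      exact zero_mem _
  · rw [Submodule.span_le]
    rintro _ ⟨b, hb, rfl⟩
    rw [Set.mem_ofPred_eq] at hb
    refine ⟨basisEntry B b.1.1 (b.1.2 + l), ?_⟩
    rw [hB.pow_apply_basisEntry _ (by omega), add_sub_cancel_right, basisEntry_box]

theorem ker_eq_span (hB : IsColoredJordanBasis V x B) :
    LinearMap.ker x = Submodule.span F (B '' {b | b.1.2 = 1}) := by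
  apply le_antisymm
  · intro w hw
    rw [Module.Basis.mem_span_image, Finsupp.support_subset_iff]
    intro b hb
    have := b.2.1
    have hcol : (b.1.2 : ℤ) ≠ 1 := fun h => hb (Nat.cast_injective h)
    have hcoord := hB.basisCoord_pow b.1.1 (j := b.1.2 - 1) (by omega) 1 w
    rwa [pow_one, LinearMap.mem_ker.mp hw, map_zero, Nat.cast_one, sub_add_cancel, basisCoord_box,
      eq_comm] at hcoord
  · rw [Submodule.span_le]
    rintro _ ⟨b, hb, rfl⟩
    rw [Set.mem_ofPred_eq] at hb
    rw [SetLike.mem_coe, LinearMap.mem_ker, hB.2, basisEntry_of_nonpos B _ (by omega)]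

variable (hV : DirectSum.IsInternal V)
include hV

theorem eq_span (hB : IsColoredJordanBasis V x B) (m : ZMod n) :
    V m = Submodule.span F (B '' {b | p.boxColor b = m}) :=
  (span_basis_image_fiber_eq hV.submodule_iSupIndep B hB.1 m).symm

theorem basisCoord_eq_zero_of_mem (hB : IsColoredJordanBasis V x B) {m : ZMod n} {w : W}
    (hw : w ∈ V m) {i : ℕ} {j : ℤ} (h : p.entryColor i j ≠ m) : basisCoord B i j w = 0 := by
  by_cases hij : 1 ≤ j ∧ j ≤ p.len i
  · obtain ⟨b, rfl, rfl⟩ := p.exists_box hij.1 hij.2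
    rw [hB.eq_span hV, Module.Basis.mem_span_image, Finsupp.support_subset_iff] at hw
    rw [basisCoord_box]
    exact hw b fun hb => h ((p.entryColor_box b).trans hb)
  · rw [basisCoord_eq_zero B hij, LinearMap.zero_apply]

theorem signature_eq (hB : IsColoredJordanBasis V x B) : p.signature = spaceSignature V := by
  funext m
  rw [spaceSignature, hB.eq_span hV, finrank_span_basis_image]
  rfl

theorem finrank_range_inf_ker (hB : IsColoredJordanBasis V x B) (l : ℕ) (m : ZMod n) :
    Module.finrank F (LinearMap.range (x ^ l) ⊓ LinearMap.ker x ⊓ V m : Submodule F W) =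
      {i | l < p.len i ∧ p.entryColor i 1 = m}.ncard := by
  rw [hB.range_pow_eq_span, hB.ker_eq_span, hB.eq_span hV, ← span_basis_image_inter,
    ← span_basis_image_inter, finrank_span_basis_image]
  refine Set.ncard_congr (fun b _ => b.1.1) ?_ ?_ ?_
  · rintro b ⟨⟨hl, h1⟩, hm⟩
    rw [Set.mem_ofPred_eq] at hl h1 hm
    rw [← p.entryColor_box, h1, Nat.cast_one] at hm
    exact ⟨by omega, hm⟩
  · rintro b b' ⟨⟨-, h1⟩, -⟩ ⟨⟨-, h1'⟩, -⟩ hrow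
    exact Subtype.ext (Prod.ext hrow (h1.trans h1'.symm))
  · rintro i ⟨hl, hm⟩
    obtain ⟨b, rfl, hb⟩ := p.exists_box (i := i) le_rfl (by omega)
    rw [← hb, p.entryColor_box] at hm
    exact ⟨b, ⟨⟨by rw [Set.mem_ofPred_eq]; omega, Nat.cast_injective hb⟩, hm⟩, rfl⟩

theorem rowEquiv (hB : IsColoredJordanBasis V x B) {q : ColoredPartition n}
    {C : Module.Basis q.Box F W} (hC : IsColoredJordanBasis V x C) : p.RowEquiv q := by
  refine ColoredPartition.rowEquiv_of_valueCount_eq ?_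
  rintro ⟨_ | l, c⟩ hl
  · exact absurd hl (lt_irrefl 0)
  · have hp := p.ncard_long_rows l c
    rw [← hB.finrank_range_inf_ker hV, ← hB.finrank_range_inf_ker hV, hC.finrank_range_inf_ker hV,
      hC.finrank_range_inf_ker hV, q.ncard_long_rows] at hp
    exact (ENat.add_left_injective_of_ne_top (ENat.natCast_ne_top _) hp).symm

end IsColoredJordanBasis

/-! ### Existence of colored Jordan bases -/

section Existence

variable {n : ℕ} {F W : Type*} [Field F] [AddCommGroup W] [Module F W]
  {V : ZMod n → Submodule F W} {x : Module.End F W}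

theorem pow_apply_mem_of_mem_nilpotentCone (hx : x ∈ nilpotentCone V) (k : ℕ) {m : ZMod n} {w : W}
    (hw : w ∈ V m) : (x ^ k) w ∈ V (m + k) := by
  induction k with
  | zero => simpa using hw
  | succ k ih =>
    rw [pow_succ', Module.End.mul_apply, Nat.cast_succ, ← add_assoc]
    exact hx.2 _ _ ih

theorem apply_basisEntry_of_tops {p : ColoredPartition n} {B : Module.Basis p.Box F W}
    {T : Module.End F W} {top : ℕ → W} (hpow : ∀ i, (x ^ p.len i) (top i) = 0)
    (hT : ∀ b, T (B b) = (x ^ (p.len b.1.1 - b.1.2)) (top b.1.1)) (i k : ℕ) :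
    T (basisEntry B i (p.len i - k)) = (x ^ k) (top i) := by
  rcases lt_or_ge k (p.len i) with hk | hk
  · obtain ⟨b, rfl, hb⟩ := p.exists_box (i := i) (by omega : 1 ≤ (p.len i : ℤ) - k) (by omega)
    rw [← hb, basisEntry_box, hT]
    congr 2
    omega
  · rw [basisEntry_of_nonpos B i (by omega), map_zero, Module.End.pow_map_zero_of_le hk (hpow i)]

theorem isColoredJordanBasis_of_tops {p : ColoredPartition n} (hx : x ∈ nilpotentCone V)
    {B : Module.Basis p.Box F W} {top : ℕ → W} (hmem : ∀ i, top i ∈ V (p.color i))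
    (hpow : ∀ i, (x ^ p.len i) (top i) = 0)
    (hB : ∀ b, B b = (x ^ (p.len b.1.1 - b.1.2)) (top b.1.1)) :
    IsColoredJordanBasis V x B := by
  refine ⟨fun b => ?_, fun b => ?_⟩
  · rw [hB]
    exact pow_apply_mem_of_mem_nilpotentCone hx _ (hmem _)
  · have := b.2.2
    rw [hB, ← Module.End.mul_apply, ← pow_succ', ← apply_basisEntry_of_tops (T := 1) hpow hB]
    refine congrArg (basisEntry B b.1.1) ?_
    omega

theorem IsColoredJordanBasis.mem_nilpotentCone {p : ColoredPartition n} (hV : iSupIndep V)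
    {B : Module.Basis p.Box F W} (hB : IsColoredJordanBasis V x B) : x ∈ nilpotentCone V := by
  refine ⟨⟨p.len 0, B.ext fun b => ?_⟩, fun m => ?_⟩
  · have := b.2.2
    have := p.antitone_len (Nat.zero_le b.1.1)
    rw [← basisEntry_box, hB.pow_apply_basisEntry _ (by omega), basisEntry_of_nonpos _ _ (by omega),
      LinearMap.zero_apply]
  · rw [← span_basis_image_fiber_eq hV B hB.1 m]
    change _ ≤ (V (m + 1)).comap x
    rw [Submodule.span_le]
    rintro _ ⟨b, rfl, rfl⟩
    have hcolor : p.entryColor b.1.1 (b.1.2 - 1) = p.boxColor b + 1 := by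
      rw [sub_eq_add_neg, p.entryColor_add, p.entryColor_box, Int.cast_neg, Int.cast_one,
        sub_neg_eq_add]
    rw [SetLike.mem_coe, Submodule.mem_comap, hB.2, ← hcolor]
    exact hB.basisEntry_mem _ _

theorem exists_isColoredJordanBasis_of_signature [FiniteDimensional F W]
    (hV : DirectSum.IsInternal V) (p : ColoredPartition n) (hp : p.signature = spaceSignature V) :
    ∃ x ∈ nilpotentCone V, ∃ B : Module.Basis p.Box F W, IsColoredJordanBasis V x B := by
  have boxesOfColor (m : ZMod n) :
      Nonempty (Fin (Module.finrank F (V m)) ≃ {b : p.Box // p.boxColor b = m}) :=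
    ⟨(Finite.equivFinOfCardEq (congrFun hp m)).symm⟩
  let E : (Σ m, Fin (Module.finrank F (V m))) ≃ p.Box :=
    (Equiv.sigmaCongrRight fun m => (boxesOfColor m).some).trans (Equiv.sigmaFiberEquiv p.boxColor)
  have hE (s) : p.boxColor (E s) = s.1 := ((boxesOfColor s.1).some s.2).2
  let B : Module.Basis p.Box F W :=
    (hV.collectedBasis fun m => Module.finBasis F (V m)).reindex E
  have hB (b) : B b ∈ V (p.boxColor b) := by
    obtain ⟨s, rfl⟩ := E.surjective b
    rw [hE, Module.Basis.reindex_apply, Equiv.symm_apply_apply]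
    exact hV.collectedBasis_mem _ s
  let x : Module.End F W := B.constr F fun b => basisEntry B b.1.1 ((b.1.2 : ℤ) - 1)
  have hBx : IsColoredJordanBasis V x B := ⟨hB, fun b => B.constr_basis F _ b⟩
  exact ⟨x, hBx.mem_nilpotentCone hV.submodule_iSupIndep, B, hBx⟩

/-- The span of `v, x v, …, x ^ (l - 1) v`. -/
def chainSpan (x : Module.End F W) (l : ℕ) (v : W) : Submodule F W :=
  Submodule.span F (Set.range fun j : Fin l => (x ^ (j : ℕ)) v)

theorem chainSpan_le {U : Submodule F W} (hU : ∀ w ∈ U, x w ∈ U) (l : ℕ) {v : W} (hv : v ∈ U) :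
    chainSpan x l v ≤ U := by
  rw [chainSpan, Submodule.span_le]
  rintro _ ⟨j, rfl⟩
  exact Module.End.pow_apply_mem_of_forall_mem j hU v hv

/-- The functionals `φ ∘ x ^ a`, `a < l`. They detect a Jordan chain of length `l` whose last
vector is not killed by `φ`, so that their common kernel is a complement of that chain. -/
def chainFunctionals (x : Module.End F W) (l : ℕ) (φ : W →ₗ[F] F) : W →ₗ[F] (Fin l → F) :=
  LinearMap.pi fun a => φ ∘ₗ x ^ (a : ℕ)

theorem mem_ker_chainFunctionals {l : ℕ} {φ : W →ₗ[F] F} {w : W} :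
    w ∈ LinearMap.ker (chainFunctionals x l φ) ↔ ∀ a < l, φ ((x ^ a) w) = 0 := by
  rw [LinearMap.mem_ker, funext_iff, Fin.forall_iff]
  rfl

theorem exists_mem_chainSpan_chainFunctionals_eq {φ : W →ₗ[F] F} {v : W} {K : ℕ}
    (hφ : φ ((x ^ K) v) ≠ 0) (hv : (x ^ (K + 1)) v = 0) (y : Fin (K + 1) → F) :
    ∃ w ∈ chainSpan x (K + 1) v, chainFunctionals x (K + 1) φ w = y := by
  let M : Matrix (Fin (K + 1)) (Fin (K + 1)) F := fun a k => φ ((x ^ (a + (K - k) : ℕ)) v)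
  have triangular : M.IsUpperTriangular := fun a k (hk : k < a) => by
    have := k.2
    obtain ⟨d, hd⟩ := Nat.exists_eq_add_of_le' (by omega : K + 1 ≤ a + (K - k))
    change φ ((x ^ (a + (K - k) : ℕ)) v) = 0
    rw [hd, pow_add, Module.End.mul_apply, hv, map_zero, map_zero]
  have diagonal (a) : M a a = φ ((x ^ K) v) := by
    change φ ((x ^ (a + (K - a) : ℕ)) v) = _
    rw [Nat.add_sub_cancel' (by omega)]
  have unit : IsUnit M := by
    rw [Matrix.isUnit_iff_isUnit_det, Matrix.det_of_isUpperTriangular triangular,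
      isUnit_iff_ne_zero]
    exact Finset.prod_ne_zero_iff.mpr fun a _ => diagonal a ▸ hφ
  obtain ⟨c, hc⟩ := Matrix.mulVec_surjective_iff_isUnit.mpr unit y
  refine ⟨∑ k : Fin (K + 1), c k • (x ^ (K - k : ℕ)) v, Submodule.sum_mem _ fun k _ =>
    Submodule.smul_mem _ _ (Submodule.subset_span ⟨⟨K - k, by omega⟩, rfl⟩), ?_⟩
  rw [← hc]
  funext a
  simp only [chainFunctionals, LinearMap.pi_apply, LinearMap.comp_apply, map_sum, map_smul,
    smul_eq_mul, Matrix.mulVec, dotProduct, M, pow_add, Module.End.mul_apply, mul_comm]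

theorem le_chainSpan_sup_inf_ker {U : Submodule F W} (hU : ∀ w ∈ U, x w ∈ U) {φ : W →ₗ[F] F}
    {v : W} {K : ℕ} (hφ : φ ((x ^ K) v) ≠ 0) (hv : (x ^ (K + 1)) v = 0) (hvU : v ∈ U) :
    U ≤ chainSpan x (K + 1) v ⊔ U ⊓ LinearMap.ker (chainFunctionals x (K + 1) φ) := by
  intro w hw
  obtain ⟨u, hu, huw⟩ :=
    exists_mem_chainSpan_chainFunctionals_eq hφ hv (chainFunctionals x (K + 1) φ w)
  rw [← add_sub_cancel u w]
  refine Submodule.add_mem_sup hu ⟨sub_mem hw (chainSpan_le hU _ hvU hu), ?_⟩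
  rw [SetLike.mem_coe, LinearMap.mem_ker, map_sub, huw, sub_self]

theorem finrank_inf_ker_chainFunctionals [FiniteDimensional F W] {U : Submodule F W}
    (hU : ∀ w ∈ U, x w ∈ U) {φ : W →ₗ[F] F} {v : W} {K : ℕ} (hφ : φ ((x ^ K) v) ≠ 0)
    (hv : (x ^ (K + 1)) v = 0) (hvU : v ∈ U) :
    Module.finrank F ↥(U ⊓ LinearMap.ker (chainFunctionals x (K + 1) φ)) + (K + 1) =
      Module.finrank F U := by
  have hrange : LinearMap.range ((chainFunctionals x (K + 1) φ).domRestrict U) = ⊤ := by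
    rw [LinearMap.range_eq_top]
    intro y
    obtain ⟨w, hw, rfl⟩ := exists_mem_chainSpan_chainFunctionals_eq hφ hv y
    exact ⟨⟨w, chainSpan_le hU _ hvU hw⟩, rfl⟩
  have hrank :=
    LinearMap.finrank_range_add_finrank_ker ((chainFunctionals x (K + 1) φ).domRestrict U)
  rw [hrange, finrank_top, Module.finrank_fin_fun, LinearMap.domRestrict, LinearMap.ker_comp,
    ← Submodule.finrank_map_subtype_eq, Submodule.map_comap_subtype] at hrank
  omega

theorem inf_ker_chainFunctionals_stable {U : Submodule F W} (hU : ∀ w ∈ U, x w ∈ U) {l : ℕ}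
    (hl : U ≤ LinearMap.ker (x ^ l)) (φ : W →ₗ[F] F) :
    ∀ w ∈ U ⊓ LinearMap.ker (chainFunctionals x l φ),
      x w ∈ U ⊓ LinearMap.ker (chainFunctionals x l φ) := by
  rintro w ⟨hw, hker⟩
  rw [SetLike.mem_coe, mem_ker_chainFunctionals] at hker
  refine ⟨hU w hw, mem_ker_chainFunctionals.mpr fun a ha => ?_⟩
  rw [← Module.End.mul_apply, ← pow_succ]
  rcases Nat.succ_le_iff.mpr ha |>.eq_or_lt with rfl | ha'
  · rw [LinearMap.mem_ker.mp (hl hw), map_zero]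
  · exact hker _ ha'

theorem inf_ker_chainFunctionals_le_iSup (hx : x ∈ nilpotentCone V) {U : Submodule F W}
    (hom : U ≤ ⨆ m, V m ⊓ U) {φ : W →ₗ[F] F} {c : ZMod n} (hφ : ∀ m ≠ c, V m ≤ LinearMap.ker φ)
    (l : ℕ) :
    U ⊓ LinearMap.ker (chainFunctionals x l φ) ≤
      ⨆ m, V m ⊓ (U ⊓ LinearMap.ker (chainFunctionals x l φ)) := by
  rintro w ⟨hw, hker⟩
  rw [SetLike.mem_coe, mem_ker_chainFunctionals] at hker
  obtain ⟨f, hf, hsum⟩ := (Submodule.mem_iSup_iff_exists_finsupp _ _).mp (hom hw)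
  have hmem (a : ℕ) (m) : (x ^ a) (f m) ∈ V (m + a) :=
    pow_apply_mem_of_mem_nilpotentCone hx a (hf m).1
  refine (Submodule.mem_iSup_iff_exists_finsupp _ _).mpr ⟨f, fun m => ⟨(hf m).1, (hf m).2,
    mem_ker_chainFunctionals.mpr fun a ha => ?_⟩, hsum⟩
  by_cases hm : m + a = c
  · have hzero := hker a ha
    rw [← hsum, Finsupp.sum, map_sum, map_sum, Finset.sum_eq_single m] at hzero
    · exact hzero
    · exact fun m' _ hm' => hφ _ (fun h => hm' (add_right_cancel (h.trans hm.symm))) (hmem a m')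
    · intro h
      rw [Finsupp.notMem_support_iff.mp h, map_zero, map_zero]
  · exact hφ _ hm (hmem a m)

theorem exists_longest_chain (hx : IsNilpotent x) {U : Submodule F W} (hne : U ≠ ⊥)
    (hom : U ≤ ⨆ m, V m ⊓ U) :
    ∃ K c, ∃ v ∈ V c ⊓ U, (x ^ K) v ≠ 0 ∧ U ≤ LinearMap.ker (x ^ (K + 1)) := by
  classical
  have hex : ∃ k, U ≤ LinearMap.ker (x ^ k) := by
    obtain ⟨k, hk⟩ := hx
    exact ⟨k, by rw [hk, LinearMap.ker_zero]; exact le_top⟩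
  obtain ⟨K, hK⟩ : ∃ K, Nat.find hex = K + 1 := by
    refine Nat.exists_eq_succ_of_ne_zero fun h => hne (eq_bot_iff.mpr ?_)
    simpa [h, Module.End.one_eq_id] using Nat.find_spec hex
  have hvanish : ¬ U ≤ LinearMap.ker (x ^ K) := Nat.find_min hex (by omega)
  by_contra! h
  refine hvanish (hom.trans (iSup_le fun c v hv => ?_))
  by_contra hne
  exact h K c v hv hne (hK ▸ Nat.find_spec hex)

theorem exists_functional_of_mem (hV : iSupIndep V) {c : ZMod n} {w : W} (hw : w ∈ V c)
    (hne : w ≠ 0) : ∃ φ : W →ₗ[F] F, φ w ≠ 0 ∧ ∀ m ≠ c, V m ≤ LinearMap.ker φ := by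
  obtain ⟨φ, hφw, hφ⟩ := Submodule.exists_le_ker_of_notMem fun h =>
    hne (Submodule.disjoint_def.mp (hV c) w hw h)
  exact ⟨φ, hφw, fun m hm => (le_iSup₂_of_le m hm le_rfl).trans hφ⟩

/-- A homogeneous vector `top` killed by `x ^ len`, generating the Jordan chain
`top, x top, …, x ^ (len - 1) top` of a colored nilpotent endomorphism. -/
structure JordanChain (V : ZMod n → Submodule F W) (x : Module.End F W) where
  len : ℕ
  color : ZMod n
  top : W
  top_mem : top ∈ V color
  pow_top : (x ^ len) top = 0

theorem exists_jordanChains [FiniteDimensional F W] (hV : iSupIndep V) (hx : x ∈ nilpotentCone V)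
    (U : Submodule F W) (hU : ∀ w ∈ U, x w ∈ U) (hom : U ≤ ⨆ m, V m ⊓ U) :
    ∃ (ι : Type) (_ : Fintype ι) (t : ι → JordanChain V x),
      U ≤ ⨆ i, chainSpan x (t i).len (t i).top ∧ ∑ i, (t i).len ≤ Module.finrank F U := by
  induction hd : Module.finrank F U using Nat.strong_induction_on generalizing U with
  | _ d ih =>
    rcases eq_or_ne U ⊥ with rfl | hne
    · exact ⟨Empty, inferInstance, Empty.elim, bot_le, by simp⟩
    obtain ⟨K, c, v, ⟨hvc, hvU⟩, hvK, hK⟩ := exists_longest_chain hx.1 hne hom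
    have hv : (x ^ (K + 1)) v = 0 := hK hvU
    obtain ⟨φ, hφv, hφ⟩ :=
      exists_functional_of_mem hV (pow_apply_mem_of_mem_nilpotentCone hx K hvc) hvK
    have hrank := finrank_inf_ker_chainFunctionals hU hφv hv hvU
    obtain ⟨ι, _, t, hspan, hlen⟩ := ih _ (by omega) _ (inf_ker_chainFunctionals_stable hU hK φ)
      (inf_ker_chainFunctionals_le_iSup hx hom hφ (K + 1)) rfl
    refine ⟨Option ι, inferInstance, fun o => o.elim ⟨K + 1, c, v, hvc, hv⟩ t, ?_, ?_⟩
    · rw [iSup_option]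
      exact (le_chainSpan_sup_inf_ker hU hφv hv hvU).trans (sup_le_sup_left hspan _)
    · rw [Fintype.sum_option, ← hd, ← hrank, add_comm]
      exact Nat.add_le_add_right hlen _

theorem exists_jordanChain_basis [FiniteDimensional F W] (hV : DirectSum.IsInternal V)
    (hx : x ∈ nilpotentCone V) :
    ∃ (ι : Type) (_ : Finite ι) (t : ι → JordanChain V x)
      (B : Module.Basis (Σ i, Fin (t i).len) F W), ∀ s, B s = (x ^ (s.2 : ℕ)) (t s.1).top := by
  obtain ⟨ι, _, t, hspan, hlen⟩ := exists_jordanChains hV.submodule_iSupIndep hx ⊤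
    (fun _ _ => Submodule.mem_top) (by simp only [inf_top_eq, hV.submodule_iSup_eq_top, le_refl])
  let b (s : Σ i, Fin (t i).len) : W := (x ^ (s.2 : ℕ)) (t s.1).top
  have hb : ⊤ ≤ Submodule.span F (Set.range b) := by
    refine hspan.trans (iSup_le fun i => Submodule.span_mono ?_)
    rintro _ ⟨j, rfl⟩
    exact ⟨⟨i, j⟩, rfl⟩
  have hcard : Fintype.card (Σ i, Fin (t i).len) = Module.finrank F W := by
    apply le_antisymm
    · simpa only [Fintype.card_sigma, Fintype.card_fin, finrank_top] using hlen
    · have h := finrank_range_le_card (R := F) b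
      rwa [Set.finrank, top_le_iff.mp hb, finrank_top] at h
  exact ⟨ι, inferInstance, t, basisOfTopLeSpanOfCardEqFinrank b hb hcard, fun s => by
    rw [coe_basisOfTopLeSpanOfCardEqFinrank]⟩

theorem exists_isColoredJordanBasis [NeZero n] [FiniteDimensional F W]
    (hV : DirectSum.IsInternal V) (hx : x ∈ nilpotentCone V) :
    ∃ (p : ColoredPartition n) (B : Module.Basis p.Box F W), IsColoredJordanBasis V x B := by
  obtain ⟨ι, _, t, B, hB⟩ := exists_jordanChain_basis hV hx
  obtain ⟨p, e, he⟩ :=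
    ColoredPartition.exists_row_eq_sumElim fun i => ((t i).len, (t i).color)
  obtain ⟨E, hE⟩ := ColoredPartition.exists_sigma_equiv_box he
  have hrow (i) := congrFun he i
  refine ⟨p, B.reindex E, isColoredJordanBasis_of_tops hx
    (top := fun i => Sum.elim (fun a => (t a).top) 0 (e i)) (fun i => ?_) (fun i => ?_) fun b => ?_⟩
  · rcases hi : e i with a | a
    · have hcolor : p.color i = (t a).color := by
        simpa [ColoredPartition.row, hi] using congrArg Prod.snd (hrow i)
      simpa [hcolor] using (t a).top_mem
    · exact zero_mem _
  · rcases hi : e i with a | a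
    · have hlen : p.len i = (t a).len := by
        simpa [ColoredPartition.row, hi] using congrArg Prod.fst (hrow i)
      simpa [hlen] using (t a).pow_top
    · exact map_zero _
  · obtain ⟨s, rfl⟩ := E.surjective b
    rw [Module.Basis.reindex_apply, Equiv.symm_apply_apply, hB, (hE s).1, (hE s).2]
    rfl

end Existence

/-! ### Marked Jordan bases and their orbits -/

section MarkVector

variable {n : ℕ} {F W : Type*} [Field F] [AddCommGroup W] [Module F W] {p : ColoredPartition n}

/-- The vector `∑ i, v_{i, μ i}` attached to the marking `μ` of the basis `v_{i,j}`. -/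
noncomputable def markVector (B : Module.Basis p.Box F W) (μ : ℕ → ℤ) : W :=
  ∑ i ∈ Finset.range p.length, basisEntry B i (μ i)

theorem markVector_map (B : Module.Basis p.Box F W) (k : W ≃ₗ[F] W) (μ : ℕ → ℤ) :
    markVector (B.map k) μ = k (markVector B μ) := by
  simp only [markVector, basisEntry_map, map_sum]

theorem basisCoord_markVector (B : Module.Basis p.Box F W) (μ : ℕ → ℤ) {i : ℕ} {j : ℤ}
    (h1 : 1 ≤ j) (h2 : j ≤ p.len i) :
    basisCoord B i j (markVector B μ) = if j = μ i then 1 else 0 := by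
  have hi : i ∈ Finset.range p.length := Finset.mem_range.mpr ((p.lt_length_iff i).mpr (by omega))
  rw [markVector, map_sum, Finset.sum_eq_single_of_mem i hi]
  · rw [basisCoord_basisEntry]
    exact if_congr (by tauto) rfl rfl
  · intro i' _ hne
    rw [basisCoord_basisEntry, if_neg fun h => hne h.1.symm]

theorem markVector_update_zero_add (B : Module.Basis p.Box F W) (μ : ℕ → ℤ) {i : ℕ}
    (hi : i < p.length) :
    markVector B (Function.update μ i 0) + basisEntry B i (μ i) = markVector B μ := by
  have hsingle : basisEntry B i (μ i) =
      ∑ r ∈ Finset.range p.length, if r = i then basisEntry B i (μ i) else 0 := by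
    rw [Finset.sum_ite_eq', if_pos (Finset.mem_range.mpr hi)]
  rw [hsingle, markVector, ← Finset.sum_add_distrib]
  refine Finset.sum_congr rfl fun r _ => ?_
  rcases eq_or_ne r i with rfl | hr
  · rw [Function.update_self, basisEntry_of_nonpos B r le_rfl, zero_add, if_pos rfl]
  · rw [Function.update_of_ne hr, if_neg hr, add_zero]

namespace IsColoredJordanBasis

variable {V : ZMod n → Submodule F W} {x : Module.End F W} {B : Module.Basis p.Box F W} {μ : ℕ → ℤ}

theorem pow_markVector (hB : IsColoredJordanBasis V x B) (hμ : ∀ i, μ i ≤ p.len i) (k : ℕ) :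
    (x ^ k) (markVector B μ) = markVector B fun i => μ i - k := by
  rw [markVector, map_sum]
  exact Finset.sum_congr rfl fun i _ => hB.pow_apply_basisEntry i (hμ i) k

theorem pow_markVector_mem_range_iff (hB : IsColoredJordanBasis V x B) (hμ : ∀ i, μ i ≤ p.len i)
    (k l : ℕ) :
    (x ^ k) (markVector B μ) ∈ LinearMap.range (x ^ l) ↔
      ∀ i, μ i ≤ k ∨ μ i - k + l ≤ p.len i := by
  rw [hB.pow_markVector hμ, hB.range_pow_eq_span, Module.Basis.mem_span_image,
    Finsupp.support_subset_iff]
  constructor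
  · intro h i
    by_contra! hi
    have hlen := hμ i
    obtain ⟨b, rfl, hb⟩ := p.exists_box (i := i) (by omega : 1 ≤ μ i - k) (by omega)
    have hcoord := h b (by rw [Set.mem_ofPred_eq]; omega)
    rw [← basisCoord_box, hb, basisCoord_markVector B _ (by omega) (by omega), if_pos rfl] at hcoord
    exact one_ne_zero hcoord
  · intro h b hb
    have hb' := b.2
    have hi := h b.1.1
    rw [Set.mem_ofPred_eq] at hb
    rw [← basisCoord_box, basisCoord_markVector B _ (by omega) (by omega), if_neg (by omega)]

theorem markVector_mem_iff (hV : DirectSum.IsInternal V) (hB : IsColoredJordanBasis V x B)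
    (hμ : ∀ i, μ i ≤ p.len i) {m : ZMod n} :
    markVector B μ ∈ V m ↔ ∀ i, 0 < μ i → p.entryColor i (μ i) = m := by
  constructor
  · intro h i hi
    by_contra hne
    have hcoord := hB.basisCoord_eq_zero_of_mem hV h hne
    rw [basisCoord_markVector B μ (by omega) (hμ i), if_pos rfl] at hcoord
    exact one_ne_zero hcoord
  · intro h
    refine Submodule.sum_mem _ fun i _ => ?_
    by_cases hi : 0 < μ i
    · rw [← h i hi]
      exact hB.basisEntry_mem i (μ i)
    · rw [basisEntry_of_nonpos B i (by omega)]
      exact zero_mem _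

end IsColoredJordanBasis

end MarkVector

section EnhancedOrbits

variable {n : ℕ} {F W : Type*} [Field F] [AddCommGroup W] [Module F W]
  {V : ZMod n → Submodule F W}

theorem self_mem_enhancedOrbit (V : ZMod n → Submodule F W) (a : W × Module.End F W) :
    a ∈ enhancedOrbit V a :=
  ⟨1, one_mem _, by ext <;> rfl⟩

theorem enhancedOrbit_eq_of_mem {a b : W × Module.End F W} (h : a ∈ enhancedOrbit V b) :
    enhancedOrbit V a = enhancedOrbit V b := by
  have subset_of_mem {a b : W × Module.End F W} (h : a ∈ enhancedOrbit V b) :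
      enhancedOrbit V a ⊆ enhancedOrbit V b := by
    obtain ⟨k, hk, rfl⟩ := h
    rintro _ ⟨l, hl, rfl⟩
    exact ⟨l * k, mul_mem hl hk, by ext <;> rfl⟩
  refine (subset_of_mem h).antisymm (subset_of_mem ?_)
  obtain ⟨k, hk, rfl⟩ := h
  refine ⟨k⁻¹, inv_mem hk, ?_⟩
  refine Prod.ext (k.symm_apply_apply _).symm (LinearMap.ext fun w => ?_)
  change b.2 w = k.symm (k (b.2 (k.symm (k w))))
  rw [k.symm_apply_apply, k.symm_apply_apply]

theorem apply_mem_of_mem_colorGroup {k : W ≃ₗ[F] W} (hk : k ∈ colorGroup V) {m : ZMod n} {w : W}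
    (hw : w ∈ V m) : k w ∈ V m := by
  rw [← hk m]
  exact Submodule.mem_map_of_mem hw

variable {p : ColoredPartition n} {x : Module.End F W} {B : Module.Basis p.Box F W}

theorem IsColoredJordanBasis.map (hB : IsColoredJordanBasis V x B) {k : W ≃ₗ[F] W}
    (hk : k ∈ colorGroup V) : IsColoredJordanBasis V (k.conj x) (B.map k) := by
  refine ⟨fun b => apply_mem_of_mem_colorGroup hk (hB.1 b), fun b => ?_⟩
  rw [basisEntry_map, ← hB.2, Module.Basis.map_apply, LinearEquiv.conj_apply_apply,
    LinearEquiv.symm_apply_apply]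

theorem IsColoredJordanBasis.exists_mem_colorGroup (hV : DirectSum.IsInternal V)
    (hB : IsColoredJordanBasis V x B) {y : Module.End F W} {C : Module.Basis p.Box F W}
    (hC : IsColoredJordanBasis V y C) :
    ∃ k ∈ colorGroup V, C = B.map k ∧ y = k.conj x := by
  let k : W ≃ₗ[F] W := B.equiv C (Equiv.refl _)
  have hkB (b) : k (B b) = C b := B.equiv_apply b C (Equiv.refl _)
  have hCB : C = B.map k := Module.Basis.eq_of_apply_eq fun b => (hkB b).symm
  have hk : k ∈ colorGroup V := by
    intro m
    nth_rw 1 [hB.eq_span hV m]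
    rw [Submodule.map_span, Set.image_image, hC.eq_span hV m]
    simp only [LinearEquiv.coe_coe, hkB]
  refine ⟨k, hk, hCB, C.ext fun b => ?_⟩
  have hmap := (hB.map hk).2 b
  rw [← hCB] at hmap
  rw [hC.2, hmap]

theorem Psi_eq (hV : DirectSum.IsInternal V) (hx : x ∈ nilpotentCone V)
    {q : MarkedColoredPartition n} {B : Module.Basis q.Box F W} (hB : IsColoredJordanBasis V x B) :
    Psi V q = enhancedOrbit V (markVector B q.mark, x) := by
  ext a
  constructor
  · rintro ⟨y, hy, C, hC, ha⟩
    obtain ⟨k, hk, rfl, rfl⟩ := hB.exists_mem_colorGroup hV hC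
    change a ∈ enhancedOrbit V (markVector (B.map k) q.mark, k.conj x) at ha
    have hmem : (markVector (B.map k) q.mark, k.conj x) ∈
        enhancedOrbit V (markVector B q.mark, x) := ⟨k, hk, by rw [markVector_map]⟩
    rwa [enhancedOrbit_eq_of_mem hmem] at ha
  · exact fun ha => ⟨x, hx, B, hB, ha⟩

end EnhancedOrbits

/-! ### Changing the top vectors of a colored Jordan basis -/

section ChangeOfTops

variable {n : ℕ} {F W : Type*} [Field F] [AddCommGroup W] [Module F W]

theorem injective_of_commute_of_isNilpotent {x T : Module.End F W} (hx : IsNilpotent x)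
    (h : Commute T x) (hker : Disjoint (LinearMap.ker T) (LinearMap.ker x)) :
    Function.Injective T := by
  have eq_zero_of_pow (k : ℕ) (w : W) (hT : T w = 0) (hk : (x ^ k) w = 0) : w = 0 := by
    induction k with
    | zero => exact hk
    | succ k ih =>
      refine ih (Submodule.disjoint_def.mp hker _ ?_ ?_)
      · rw [LinearMap.mem_ker, ← Module.End.mul_apply, (h.pow_right k).eq, Module.End.mul_apply, hT,
          map_zero]
      · rwa [LinearMap.mem_ker, ← Module.End.mul_apply, ← pow_succ']
  obtain ⟨k, hk⟩ := hx
  refine LinearMap.ker_eq_bot.mp (LinearMap.ker_eq_bot'.mpr fun w hw => ?_)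
  exact eq_zero_of_pow k w hw (by rw [hk, LinearMap.zero_apply])

variable {V : ZMod n → Submodule F W} {p : ColoredPartition n}
  {x : Module.End F W} {B : Module.Basis p.Box F W} {μ : ℕ → ℤ}

theorem linearIndependent_basisEntry_one (B : Module.Basis p.Box F W) :
    LinearIndependent F fun r : {r // 0 < p.len r} => basisEntry B r 1 := by
  let bottom (r : {r // 0 < p.len r}) : p.Box := ⟨(r, 1), le_rfl, r.2⟩
  have hbottom : (fun r : {r // 0 < p.len r} => basisEntry B r 1) = B ∘ bottom :=
    funext fun r => basisEntry_box B (bottom r)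
  rw [hbottom]
  exact B.linearIndependent.comp _ fun r r' h => Subtype.ext (congrArg (fun b => b.1.1) h)

theorem linearIndependent_basisEntry_one_add_row (B : Module.Basis p.Box F W) {i j : ℕ}
    (hij : i ≠ j) (hi : 0 < p.len i) (s : ℕ) :
    LinearIndependent F fun r : {r // 0 < p.len r} =>
      basisEntry B r 1 + if r = j then basisEntry B i (1 - s) else 0 := by
  let c (r : {r // 0 < p.len r}) : F := if r.1 = j ∧ s = 0 then 1 else 0
  have hci : c ⟨i, hi⟩ = 0 := if_neg fun h => hij h.1
  have hc (r : {r // 0 < p.len r}) :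
      (if r = j then basisEntry B i (1 - s) else 0) = c r • basisEntry B i 1 := by
    rcases s.eq_zero_or_pos with rfl | hs
    · simp [c]
    · simp [c, hs.ne', basisEntry_of_nonpos B i (by omega : 1 - (s : ℤ) ≤ 0)]
  simp only [hc]
  exact (linearIndependent_add_smul_iff hci).mpr (linearIndependent_basisEntry_one B)

namespace IsColoredJordanBasis

theorem ker_eq_span_basisEntry_one (hB : IsColoredJordanBasis V x B) :
    LinearMap.ker x =
      Submodule.span F (Set.range fun r : {r // 0 < p.len r} => basisEntry B r 1) := by
  rw [hB.ker_eq_span]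
  congr 1
  ext w
  constructor
  · rintro ⟨b, hb, rfl⟩
    rw [Set.mem_ofPred_eq] at hb
    exact ⟨⟨b.1.1, b.2.1.trans b.2.2⟩, by simp [← basisEntry_box, hb]⟩
  · rintro ⟨⟨r, hr⟩, rfl⟩
    exact ⟨⟨(r, 1), le_rfl, hr⟩, rfl, (basisEntry_box B _).symm⟩

theorem exists_of_tops (hB : IsColoredJordanBasis V x B) (hx : x ∈ nilpotentCone V) {top : ℕ → W}
    (hmem : ∀ i, top i ∈ V (p.color i)) (hpow : ∀ i, (x ^ p.len i) (top i) = 0)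
    (hsocle : LinearIndependent F fun i : {i // 0 < p.len i} => (x ^ (p.len i - 1)) (top i)) :
    ∃ C : Module.Basis p.Box F W, IsColoredJordanBasis V x C ∧
      ∀ i, basisEntry C i (p.len i) = top i := by
  have := Module.Finite.of_basis B
  let T : Module.End F W := B.constr F fun b => (x ^ (p.len b.1.1 - b.1.2)) (top b.1.1)
  have hTB (b) : T (B b) = (x ^ (p.len b.1.1 - b.1.2)) (top b.1.1) := B.constr_basis F _ b
  have hcomm : Commute T x := by
    refine B.ext fun b => ?_
    have := b.2.2
    have hTx := apply_basisEntry_of_tops hpow hTB b.1.1 (p.len b.1.1 - b.1.2 + 1)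
    rw [pow_succ', Module.End.mul_apply, ← hTB] at hTx
    rw [Module.End.mul_apply, Module.End.mul_apply, ← hTx, hB.2]
    refine congrArg (fun j => T (basisEntry B b.1.1 j)) ?_
    omega
  have hker : Disjoint (LinearMap.ker T) (LinearMap.ker x) := by
    rw [hB.ker_eq_span_basisEntry_one]
    refine (Submodule.range_ker_disjoint ?_).symm
    convert hsocle using 1
    ext r
    rw [Function.comp_apply, ← apply_basisEntry_of_tops hpow hTB, Nat.cast_pred r.2,
      sub_sub_cancel]
  let C := B.map (LinearEquiv.ofInjectiveEndo T
    (injective_of_commute_of_isNilpotent hx.1 hcomm hker))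
  have hCB (b) : C b = (x ^ (p.len b.1.1 - b.1.2)) (top b.1.1) := hTB b
  refine ⟨C, isColoredJordanBasis_of_tops hx hmem hpow hCB, fun i => ?_⟩
  simpa using apply_basisEntry_of_tops (T := 1) hpow hCB i 0

theorem exists_add_row (hB : IsColoredJordanBasis V x B) (hx : x ∈ nilpotentCone V) {i j s : ℕ}
    (hij : i ≠ j) (hi : 0 < p.len i) (hlen : p.len j ≤ p.len i + s)
    (hc : p.entryColor i (p.len j - s) = p.color j) :
    ∃ C : Module.Basis p.Box F W, IsColoredJordanBasis V x C ∧ ∀ (r : ℕ) (a : ℤ), a ≤ p.len r →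
      basisEntry C r a = basisEntry B r a + if r = j then basisEntry B i (a - s) else 0 := by
  let top (r : ℕ) : W :=
    basisEntry B r (p.len r) + if r = j then basisEntry B i (p.len r - s) else 0
  have pow_top (r k : ℕ) : (x ^ k) (top r) = basisEntry B r (p.len r - k) +
      if r = j then basisEntry B i (p.len r - k - s) else 0 := by
    rw [map_add, hB.pow_apply_basisEntry r le_rfl]
    split
    · next hr =>
      subst hr
      rw [hB.pow_apply_basisEntry i (by omega), sub_right_comm]
    · rw [map_zero]
  have top_mem (r : ℕ) : top r ∈ V (p.color r) := by
    refine add_mem ?_ ?_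
    · simpa only [p.entryColor_len] using hB.basisEntry_mem r (p.len r)
    · split
      · next hr =>
        rw [hr, ← hc]
        exact hB.basisEntry_mem i _
      · exact zero_mem _
  have top_pow (r : ℕ) : (x ^ p.len r) (top r) = 0 := by
    rw [pow_top, sub_self, basisEntry_of_nonpos B r le_rfl, zero_add]
    split
    · rw [basisEntry_of_nonpos B i (by omega)]
    · rfl
  obtain ⟨C, hC, htop⟩ := hB.exists_of_tops hx top_mem top_pow <| by
    convert linearIndependent_basisEntry_one_add_row B hij hi s with r
    rw [pow_top, Nat.cast_pred r.2, sub_sub_cancel]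
  refine ⟨C, hC, fun r a ha => ?_⟩
  obtain ⟨k, hk⟩ := Int.eq_ofNat_of_zero_le (sub_nonneg.mpr ha)
  obtain rfl : a = p.len r - k := by omega
  rw [← hC.pow_apply_basisEntry r le_rfl, htop, pow_top]

theorem exists_markVector_update_eq (hB : IsColoredJordanBasis V x B) (hx : x ∈ nilpotentCone V)
    (hμ : ∀ i, μ i ≤ p.len i) {i j : ℕ} (hij : i ≠ j) (h0 : 0 < μ i) (h1 : μ i ≤ μ j)
    (h2 : p.len j - μ j ≤ p.len i - μ i) (hc : p.entryColor i (μ i) = p.entryColor j (μ j)) :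
    ∃ C : Module.Basis p.Box F W, IsColoredJordanBasis V x C ∧
      markVector C (Function.update μ i 0) = markVector B μ := by
  have hi := hμ i
  have hj := hμ j
  obtain ⟨s, hs⟩ := Int.eq_ofNat_of_zero_le (sub_nonneg.mpr h1)
  have hcolor : p.entryColor i (p.len j - s) = p.color j := by
    rw [show (p.len j : ℤ) - s = μ i + (p.len j - μ j) by omega, p.entryColor_add, hc,
      ← p.entryColor_add, add_sub_cancel, p.entryColor_len]
  have hlen : p.len j ≤ p.len i + s := by omega
  obtain ⟨C, hC, hCB⟩ := hB.exists_add_row hx hij (by omega) hlen hcolor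
  let ν := Function.update μ i 0
  have hν (r : ℕ) : ν r ≤ p.len r := by
    simp only [ν, Function.update_apply]
    split
    · exact Int.natCast_nonneg _
    · exact hμ r
  refine ⟨C, hC, ?_⟩
  calc markVector C ν
      = ∑ r ∈ Finset.range p.length,
          (basisEntry B r (ν r) + if r = j then basisEntry B i (ν r - s) else 0) :=
        Finset.sum_congr rfl fun r _ => hCB r _ (hν r)
    _ = markVector B ν + basisEntry B i (μ i) := by
        have hνj : ν j - s = μ i := by
          rw [show ν j = μ j from Function.update_of_ne hij.symm _ _]
          omega
        rw [Finset.sum_add_distrib, Finset.sum_ite_eq', hνj,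
          if_pos (Finset.mem_range.mpr ((p.lt_length_iff j).mpr (by omega))), markVector]
    _ = markVector B μ := markVector_update_zero_add B μ ((p.lt_length_iff i).mpr (by omega))

end IsColoredJordanBasis

end ChangeOfTops

section LastColumn

variable {n : ℕ} {F W : Type*} [Field F] [AddCommGroup W] [Module F W] {p : ColoredPartition n}

open Classical in
/-- The last column in which `v` has a nonzero coordinate in row `i`, or `0` if there is none. -/
noncomputable def lastColumn (B : Module.Basis p.Box F W) (v : W) (i : ℕ) : ℕ :=
  {a ∈ Finset.Icc 1 (p.len i) | basisCoord B i (a : ℕ) v ≠ 0}.sup id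

variable (B : Module.Basis p.Box F W) (v : W) {i : ℕ}

theorem lastColumn_le (i : ℕ) : lastColumn B v i ≤ p.len i := by
  classical
  exact Finset.sup_le fun _ ha => (Finset.mem_Icc.mp (Finset.mem_filter.mp ha).1).2

variable {B v}

theorem basisCoord_lastColumn_ne_zero (h : lastColumn B v i ≠ 0) :
    basisCoord B i (lastColumn B v i) v ≠ 0 := by
  classical
  obtain ⟨a, ha, hsup⟩ := Finset.exists_mem_eq_sup
    {a ∈ Finset.Icc 1 (p.len i) | basisCoord B i (a : ℕ) v ≠ 0}
    (Finset.nonempty_iff_ne_empty.mpr fun hempty => h (by rw [lastColumn, hempty]; rfl)) id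
  rw [lastColumn, hsup]
  exact (Finset.mem_filter.mp ha).2

theorem basisCoord_eq_zero_of_lastColumn_lt {a : ℕ} (h : lastColumn B v i < a) :
    basisCoord B i a v = 0 := by
  classical
  by_contra hne
  by_cases ha : a ≤ p.len i
  · exact h.not_ge (Finset.le_sup (f := id)
      (Finset.mem_filter.mpr ⟨Finset.mem_Icc.mpr ⟨by omega, ha⟩, hne⟩))
  · rw [basisCoord_eq_zero B (by omega), LinearMap.zero_apply] at hne
    exact hne rfl

theorem sum_basisCoord_smul_basisEntry (B : Module.Basis p.Box F W) (v : W) :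
    ∑ i ∈ Finset.range p.length, ∑ a ∈ Finset.Icc 1 (lastColumn B v i),
      basisCoord B i a v • basisEntry B i a = v := by
  refine B.ext_elem fun b => ?_
  have hb := b.2
  have hi : b.1.1 ∈ Finset.range p.length :=
    Finset.mem_range.mpr ((p.lt_length_iff _).mpr (by omega))
  rw [← basisCoord_box, ← basisCoord_box]
  simp only [map_sum, map_smul, basisCoord_basisEntry]
  rw [Finset.sum_eq_single_of_mem _ hi]
  · by_cases hcol : b.1.2 ≤ lastColumn B v b.1.1
    · rw [Finset.sum_eq_single_of_mem b.1.2 (Finset.mem_Icc.mpr ⟨hb.1, hcol⟩)]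
      · rw [if_pos (by omega), smul_eq_mul, mul_one]
      · exact fun a _ ha => by rw [if_neg (by omega), smul_zero]
    · rw [basisCoord_eq_zero_of_lastColumn_lt (not_le.mp hcol)]
      refine Finset.sum_eq_zero fun a ha => ?_
      rw [if_neg (by have := (Finset.mem_Icc.mp ha).2; omega), smul_zero]
  · exact fun i _ hne => Finset.sum_eq_zero fun a _ => by rw [if_neg (by tauto), smul_zero]

/-- The part of `v` in row `i`, pushed to the right end of that row. If `v` has no part in row `i`,
the top vector of the row itself is taken. -/
noncomputable def rowTop (B : Module.Basis p.Box F W) (v : W) (i : ℕ) : W :=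
  if lastColumn B v i = 0 then basisEntry B i (p.len i)
  else ∑ a ∈ Finset.Icc 1 (lastColumn B v i),
    basisCoord B i a v • basisEntry B i (p.len i - lastColumn B v i + a)

namespace IsColoredJordanBasis

variable {V : ZMod n → Submodule F W} {x : Module.End F W}

theorem pow_rowTop (hB : IsColoredJordanBasis V x B) (h : lastColumn B v i ≠ 0) (k : ℕ) :
    (x ^ k) (rowTop B v i) = ∑ a ∈ Finset.Icc 1 (lastColumn B v i),
      basisCoord B i a v • basisEntry B i (p.len i - lastColumn B v i + a - k) := by
  rw [rowTop, if_neg h, map_sum]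
  refine Finset.sum_congr rfl fun a ha => ?_
  have hcol := (Finset.mem_Icc.mp ha).2
  rw [map_smul, hB.pow_apply_basisEntry i (by omega)]

theorem pow_len_rowTop (hB : IsColoredJordanBasis V x B) (v : W) (i : ℕ) :
    (x ^ p.len i) (rowTop B v i) = 0 := by
  by_cases h : lastColumn B v i = 0
  · rw [rowTop, if_pos h, hB.pow_apply_basisEntry i le_rfl, sub_self,
      basisEntry_of_nonpos B i le_rfl]
  · rw [hB.pow_rowTop h]
    refine Finset.sum_eq_zero fun a ha => ?_
    have hcol := (Finset.mem_Icc.mp ha).2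
    rw [basisEntry_of_nonpos B i (by omega), smul_zero]

theorem exists_pow_pred_len_rowTop (hB : IsColoredJordanBasis V x B) (v : W) (hi : 0 < p.len i) :
    ∃ u : Fˣ, (x ^ (p.len i - 1)) (rowTop B v i) = u • basisEntry B i 1 := by
  by_cases h : lastColumn B v i = 0
  · refine ⟨1, ?_⟩
    rw [rowTop, if_pos h, hB.pow_apply_basisEntry i le_rfl, Nat.cast_pred hi, sub_sub_cancel,
      one_smul]
  · refine ⟨Units.mk0 _ (basisCoord_lastColumn_ne_zero h), ?_⟩
    rw [hB.pow_rowTop h, Finset.sum_eq_single_of_mem (lastColumn B v i)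
      (Finset.mem_Icc.mpr ⟨by omega, le_rfl⟩), sub_add_cancel, Nat.cast_pred hi, sub_sub_cancel]
    · rfl
    · intro a ha hne
      have hcol := (Finset.mem_Icc.mp ha).2
      rw [basisEntry_of_nonpos B i (by omega), smul_zero]

theorem rowTop_mem (hB : IsColoredJordanBasis V x B) (hV : DirectSum.IsInternal V) {m : ZMod n}
    (hv : v ∈ V m) (i : ℕ) : rowTop B v i ∈ V (p.color i) := by
  have color_eq (a : ℕ) (ha : basisCoord B i a v ≠ 0) : p.entryColor i a = m := by
    by_contra hne
    exact ha (hB.basisCoord_eq_zero_of_mem hV hv hne)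
  rw [rowTop]
  split
  · simpa only [p.entryColor_len] using hB.basisEntry_mem i (p.len i)
  · next h =>
    refine sum_mem fun a _ => ?_
    by_cases ha : basisCoord B i a v = 0
    · rw [ha, zero_smul]
      exact zero_mem _
    · have hcolor : p.entryColor i (p.len i - lastColumn B v i + a) = p.color i := by
        rw [add_comm, p.entryColor_add, color_eq a ha,
          ← color_eq _ (basisCoord_lastColumn_ne_zero h), ← p.entryColor_add, add_sub_cancel,
          p.entryColor_len]
      exact hcolor ▸ Submodule.smul_mem _ _ (hB.basisEntry_mem i _)

theorem exists_markVector_eq (hB : IsColoredJordanBasis V x B) (hV : DirectSum.IsInternal V)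
    (hx : x ∈ nilpotentCone V) {m : ZMod n} (hv : v ∈ V m) :
    ∃ μ : ℕ → ℤ, 0 ≤ μ ∧ (∀ i, μ i ≤ p.len i) ∧
      ∃ C : Module.Basis p.Box F W, IsColoredJordanBasis V x C ∧ markVector C μ = v := by
  choose u hu using fun i : {i // 0 < p.len i} => hB.exists_pow_pred_len_rowTop v i.2
  obtain ⟨C, hC, htop⟩ := hB.exists_of_tops hx (hB.rowTop_mem hV hv) (hB.pow_len_rowTop v) <| by
    simp only [hu]
    exact (linearIndependent_basisEntry_one B).units_smul u
  refine ⟨fun i => lastColumn B v i, fun i => Int.natCast_nonneg _,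
    fun i => Nat.cast_le.mpr (lastColumn_le B v i), C, hC, ?_⟩
  refine (Finset.sum_congr rfl fun i _ => ?_).trans (sum_basisCoord_smul_basisEntry B v)
  by_cases h : lastColumn B v i = 0
  · simp [h, basisEntry_of_nonpos]
  · have hle := lastColumn_le B v i
    dsimp only
    rw [show (lastColumn B v i : ℤ) = p.len i - (p.len i - lastColumn B v i : ℕ) by omega,
      ← hC.pow_apply_basisEntry i le_rfl, htop, hB.pow_rowTop h]
    refine Finset.sum_congr rfl fun a _ => congrArg _ (congrArg _ ?_)
    omega

end IsColoredJordanBasis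

end LastColumn

/-! ### Orbits and minimal markings -/

section Minimal

variable {n : ℕ} {F W : Type*} [Field F] [AddCommGroup W] [Module F W]
  {V : ZMod n → Submodule F W} {x : Module.End F W} {q : MarkedColoredPartition n}

namespace IsColoredJordanBasis

variable {B : Module.Basis q.Box F W}

theorem exists_markVector_mem_iff (hV : DirectSum.IsInternal V) (hB : IsColoredJordanBasis V x B) :
    (∃ m, markVector B q.mark ∈ V m) ↔ q.MonochromaticMarks := by
  simp only [markVector_mem_iff hV hB q.mark_le]
  constructor
  · rintro ⟨m, h⟩ i j hi hj
    exact (h i hi).trans (h j hj).symm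
  · intro h
    by_cases hpos : ∃ i, 0 < q.mark i
    · obtain ⟨i, hi⟩ := hpos
      exact ⟨q.markColor i, fun j hj => h j i hj hi⟩
    · exact ⟨0, fun i hi => absurd ⟨i, hi⟩ hpos⟩

theorem exists_mark_iff (hB : IsColoredJordanBasis V x B) (hq : q.StrictMarks) (l m : ℕ) :
    (∃ i, q.len i = l ∧ q.mark i = m + 1) ↔
      (x ^ m) (markVector B q.mark) ∉ LinearMap.range (x ^ l) ∧
      (x ^ m) (markVector B q.mark) ∈ LinearMap.range (x ^ (l - 1)) ∧
      (x ^ (m + 1)) (markVector B q.mark) ∈ LinearMap.range (x ^ (l + 1)) := by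
  simp only [hB.pow_markVector_mem_range_iff q.mark_le]
  push_cast
  constructor
  · rintro ⟨i, hlen, hmark⟩
    have hle := q.mark_le i
    have hother (j : ℕ) (hj : j ≠ i) :
        q.mark j ≤ m ∨ m + 1 < q.mark j ∧ (l : ℤ) - m ≤ q.len j - q.mark j := by
      by_cases hpos : 0 < q.mark j
      · have := hq.comparable j i hj hpos (by omega)
        omega
      · omega
    refine ⟨fun h => ?_, fun j => ?_, fun j => ?_⟩
    · have := h i
      omega
    all_goals
      rcases eq_or_ne j i with rfl | hj
      · omega
      · have := hother j hj
        omega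
  · rintro ⟨hnotMem, hmem, hmem'⟩
    push Not at hnotMem
    obtain ⟨i, hmark, hlen⟩ := hnotMem
    have := hmem i
    have := hmem' i
    have := q.mark_le i
    exact ⟨i, by omega, by omega⟩

theorem exists_row_eq_iff (hV : DirectSum.IsInternal V) (hB : IsColoredJordanBasis V x B)
    (hq : q.StrictMarks) (l m : ℕ) (c : ZMod n) :
    (∃ i, q.row i = ((l, c), (m + 1 : ℤ))) ↔
      ((x ^ m) (markVector B q.mark) ∉ LinearMap.range (x ^ l) ∧
        (x ^ m) (markVector B q.mark) ∈ LinearMap.range (x ^ (l - 1)) ∧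
        (x ^ (m + 1)) (markVector B q.mark) ∈ LinearMap.range (x ^ (l + 1))) ∧
      markVector B q.mark ∈ V (c + ((l - (m + 1) : ℤ) : ZMod n)) := by
  rw [← hB.exists_mark_iff hq, markVector_mem_iff hV hB q.mark_le]
  constructor
  · rintro ⟨i, hi⟩
    obtain ⟨hshape, hmark⟩ := Prod.mk.inj hi
    obtain ⟨hlen, hcolor⟩ := Prod.mk.inj hshape
    refine ⟨⟨i, hlen, hmark⟩, fun j hj => ?_⟩
    refine (hq.monochromatic j i hj (by omega)).trans ?_
    rw [MarkedColoredPartition.markColor, hlen, hcolor, hmark]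
  · rintro ⟨⟨i, hlen, hmark⟩, hmem⟩
    have hcolor := hmem i (by omega)
    rw [ColoredPartition.entryColor, hlen, hmark, add_left_inj] at hcolor
    exact ⟨i, Prod.ext (Prod.ext hlen hcolor) hmark⟩

theorem valueCount_row_eq (hV : DirectSum.IsInternal V) (hB : IsColoredJordanBasis V x B)
    {q' : MarkedColoredPartition n} {C : Module.Basis q'.Box F W}
    (hC : IsColoredJordanBasis V x C) (hq : q.StrictMarks) (hq' : q'.StrictMarks)
    (h : markVector B q.mark = markVector C q'.mark) {t : (ℕ × ZMod n) × ℤ} (ht : 0 < t.2) :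
    valueCount q.row t = valueCount q'.row t := by
  refine valueCount_eq_of_le_one (hq.valueCount_row_le_one ht) (hq'.valueCount_row_le_one ht) ?_
  obtain ⟨⟨l, c⟩, k⟩ := t
  obtain ⟨m, rfl⟩ : ∃ m : ℕ, k = m + 1 := ⟨(k - 1).toNat, by simp only at ht; omega⟩
  rw [exists_row_eq_iff hV hB hq, exists_row_eq_iff hV hC hq', h]

end IsColoredJordanBasis

theorem exists_isMinimalMarking (hsig : q.signature = spaceSignature V) (h0 : 0 ≤ q.mark) :
    ∃ (δ : ℕ → ℤ) (h : ∀ i, δ i ≤ q.len i),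
      IsMinimalMarking V (q.withMark δ h) ∧ Psi V (q.withMark δ h) = Psi V q := by
  let totalMark (δ : ℕ → ℤ) : ℕ := ∑ i ∈ Finset.range q.length, (δ i).toNat
  obtain ⟨δ, ⟨hδ0, hδ, hPsi⟩, hmin⟩ := (measure totalMark).wf.has_min
    {δ | 0 ≤ δ ∧ ∃ h, Psi V (q.withMark δ h) = Psi V q} ⟨q.mark, h0, q.mark_le, rfl⟩
  refine ⟨δ, hδ, ⟨hsig, hδ0, fun δ' h' hδ'0 hle hPsi' => ?_⟩, hPsi⟩
  by_contra hne
  obtain ⟨i, hi⟩ := Function.ne_iff.mp hne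
  have hlt : δ' i < δ i := (hle i).lt_of_ne hi
  have hnonneg : 0 ≤ δ' i := hδ'0 i
  have hlen := hδ i
  have hdecrease : totalMark δ' < totalMark δ :=
    Finset.sum_lt_sum (fun r _ => Int.toNat_le_toNat (hle r))
      ⟨i, Finset.mem_range.mpr ((q.lt_length_iff i).mpr (by omega)), by omega⟩
  exact hmin δ' ⟨hδ'0, h', hPsi'.trans hPsi⟩ hdecrease

variable [FiniteDimensional F W]

theorem exists_isColoredJordanBasis_of_Psi_eq (hV : DirectSum.IsInternal V)
    {q' : MarkedColoredPartition n} (hq : q.signature = spaceSignature V)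
    (h : Psi V q = Psi V q') :
    ∃ (x : Module.End F W) (B : Module.Basis q.Box F W) (C : Module.Basis q'.Box F W),
      IsColoredJordanBasis V x B ∧ IsColoredJordanBasis V x C ∧
        markVector B q.mark = markVector C q'.mark := by
  obtain ⟨x, hx, B, hB⟩ := exists_isColoredJordanBasis_of_signature hV _ hq
  have hmem : (markVector B q.mark, x) ∈ Psi V q' := by
    rw [← h, Psi_eq hV hx hB]
    exact self_mem_enhancedOrbit V _
  obtain ⟨y, -, C, hC, k, hk, heq⟩ := hmem
  obtain ⟨hvec, rfl⟩ := Prod.mk.inj heq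
  exact ⟨_, B, C.map k, hB, hC.map hk, hvec.trans (markVector_map C k _).symm⟩

theorem Psi_mem_enhancedOrbits_iff (hV : DirectSum.IsInternal V)
    (hsig : q.signature = spaceSignature V) :
    Psi V q ∈ enhancedOrbits V ↔ q.MonochromaticMarks := by
  obtain ⟨x, hx, B, hB⟩ := exists_isColoredJordanBasis_of_signature hV _ hsig
  rw [Psi_eq hV hx hB, ← IsColoredJordanBasis.exists_markVector_mem_iff hV hB]
  constructor
  · rintro ⟨v, y, ⟨m, hv⟩, -, horbit⟩
    obtain ⟨k, hk, heq⟩ := horbit ▸ self_mem_enhancedOrbit V (markVector B q.mark, x)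
    exact ⟨m, (Prod.mk.inj heq).1 ▸ apply_mem_of_mem_colorGroup hk hv⟩
  · exact fun hmem => ⟨_, x, hmem, hx, rfl⟩

theorem exists_Psi_eq [NeZero n] (hV : DirectSum.IsInternal V)
    {O : Set (W × Module.End F W)} (hO : O ∈ enhancedOrbits V) :
    ∃ q : MarkedColoredPartition n, q.signature = spaceSignature V ∧ 0 ≤ q.mark ∧ Psi V q = O := by
  obtain ⟨v, x, ⟨m, hv⟩, hx, rfl⟩ := hO
  obtain ⟨p, B, hB⟩ := exists_isColoredJordanBasis hV hx
  obtain ⟨μ, h0, hle, C, hC, rfl⟩ := hB.exists_markVector_eq hV hx hv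
  exact ⟨⟨p, μ, hle⟩, hC.signature_eq hV, h0, Psi_eq (q := ⟨p, μ, hle⟩) hV hx hC⟩

theorem not_isMinimalMarking_of_le (hV : DirectSum.IsInternal V) {i j : ℕ} (hij : i ≠ j)
    (hi : 0 < q.mark i) (hmark : q.mark i ≤ q.mark j)
    (hlen : q.len j - q.mark j ≤ q.len i - q.mark i) (hcolor : q.markColor i = q.markColor j) :
    ¬ IsMinimalMarking V q := by
  rintro ⟨hsig, h0, hmin⟩
  obtain ⟨x, hx, B, hB⟩ := exists_isColoredJordanBasis_of_signature hV q.toColoredPartition hsig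
  obtain ⟨C, hC, hBC⟩ := hB.exists_markVector_update_eq hx q.mark_le hij hi hmark hlen hcolor
  have hle : Function.update q.mark i 0 ≤ q.mark := update_le_iff.mpr ⟨hi.le, fun _ _ => le_rfl⟩
  have hδ (r : ℕ) : Function.update q.mark i 0 r ≤ q.len r := (hle r).trans (q.mark_le r)
  have hPsi : Psi V (q.withMark _ hδ) = Psi V q := by
    rw [Psi_eq hV hx hB, Psi_eq (q := q.withMark _ hδ) hV hx hC, ← hBC]
    rfl
  have h := congrFun (hmin _ hδ (le_update_iff.mpr ⟨le_rfl, fun r _ => h0 r⟩) hle hPsi) i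
  rw [Function.update_self] at h
  exact hi.ne h

theorem strictMarks_of_isMinimalMarking (hV : DirectSum.IsInternal V) (hq : IsMinimalMarking V q)
    (hcolor : q.MonochromaticMarks) : q.StrictMarks := by
  refine ⟨hq.2.1, hcolor, fun i j hij hi hj => ?_⟩
  by_contra! hcomp
  by_cases h : q.mark i ≤ q.mark j ∧ q.len j - q.mark j ≤ (q.len i - q.mark i : ℤ)
  · exact not_isMinimalMarking_of_le hV hij hi h.1 h.2 (hcolor i j hi hj) hq
  · exact not_isMinimalMarking_of_le hV hij.symm hj (by omega) (by omega) (hcolor j i hj hi) hq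

theorem isMinimalMarking_of_strictMarks (hV : DirectSum.IsInternal V)
    (hsig : q.signature = spaceSignature V) (hq : q.StrictMarks) : IsMinimalMarking V q := by
  refine ⟨hsig, hq.nonneg, fun δ h h0 hle hPsi => ?_⟩
  obtain ⟨x, B, C, hB, hC, hBC⟩ :=
    exists_isColoredJordanBasis_of_Psi_eq hV (q := q.withMark δ h) hsig hPsi
  by_contra hne
  obtain ⟨i, hi⟩ := Function.ne_iff.mp hne
  have hlt : δ i < q.mark i := (hle i).lt_of_ne hi
  have hnonneg : 0 ≤ δ i := h0 i
  obtain ⟨a, ha⟩ : ∃ a : ℕ, q.mark i = a + 1 := ⟨(q.mark i - 1).toNat, by omega⟩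
  have hmem : (x ^ a) (markVector B δ) ∈ LinearMap.range (x ^ q.len i) := by
    refine (hB.pow_markVector_mem_range_iff h a _).mpr fun r => or_iff_not_imp_left.mpr fun hr => ?_
    have hr' : δ r ≤ q.mark r := hle r
    have hri : r ≠ i := by
      rintro rfl
      omega
    have := hq.comparable r i hri (by omega) (by omega)
    change δ r - a + q.len i ≤ q.len r
    omega
  have := (hC.pow_markVector_mem_range_iff q.mark_le a _).mp (hBC ▸ hmem) i
  omega

theorem exists_strictMarks_Psi_eq [NeZero n] (hV : DirectSum.IsInternal V)
    {O : Set (W × Module.End F W)} (hO : O ∈ enhancedOrbits V) :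
    ∃ q : MarkedColoredPartition n, q.signature = spaceSignature V ∧ q.StrictMarks ∧
      Psi V q = O := by
  obtain ⟨q, hsig, h0, rfl⟩ := exists_Psi_eq hV hO
  obtain ⟨δ, h, hmin, hPsi⟩ := exists_isMinimalMarking hsig h0
  have hcolor := (Psi_mem_enhancedOrbits_iff hV (q := q.withMark δ h) hsig).mp (hPsi ▸ hO)
  exact ⟨q.withMark δ h, hsig, strictMarks_of_isMinimalMarking hV hmin hcolor, hPsi⟩

end Minimal

/-! ### Characteristic colored bipartitions -/

section Characteristic

variable {n : ℕ} {F W : Type*} [Field F] [AddCommGroup W] [Module F W] [FiniteDimensional F W]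
  {V : ZMod n → Submodule F W} {p p' : MarkedColoredPartition n} {d d' : ColoredPartition n}

theorem strictMarks_of_isCharacteristicBipartition (hV : DirectSum.IsInternal V)
    (h : IsCharacteristicBipartition V (MarkedColoredPartitionClass.mk p)) :
    p.signature ≤ spaceSignature V ∧ p.StrictMarks ∧ p.FullyMarked := by
  obtain ⟨q, hmin, heq, hcolor⟩ := h
  have hqp : q.deleteUnmarked.RowEquiv p :=
    (MarkedColoredPartition.setoid n).symm (Quotient.exact heq)
  have hstrict : q.StrictMarks := strictMarks_of_isMinimalMarking hV hmin <|
    MarkedColoredPartition.MonochromaticMarks.of_deleteUnmarked (.of_lt hcolor)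
  refine ⟨?_, hstrict.deleteUnmarked.of_rowEquiv hqp,
    q.fullyMarked_deleteUnmarked.of_rowEquiv hqp⟩
  rw [← ColoredPartition.signature_eq hqp.shape, ← hmin.1,
    ← MarkedColoredPartition.signature_deleteUnmarked_add hmin.2.1]
  exact le_self_add

theorem isCharacteristicBipartition_of_strictMarks [NeZero n] (hV : DirectSum.IsInternal V)
    (hsig : p.signature ≤ spaceSignature V) (hstrict : p.StrictMarks) (hfull : p.FullyMarked) :
    IsCharacteristicBipartition V (MarkedColoredPartitionClass.mk p) := by
  obtain ⟨d, hd⟩ := ColoredPartition.exists_signature_eq (spaceSignature V - p.signature)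
  have hunion := hstrict.union_unmarked d
  have hsum : (p.union d.unmarked).signature = spaceSignature V := by
    rw [MarkedColoredPartition.signature_union, ← add_tsub_cancel_of_le hsig, ← hd]
    rfl
  obtain ⟨-, -, hlt⟩ := (MarkedColoredPartition.strictMarks_and_fullyMarked_iff _).mp
    ⟨hunion.deleteUnmarked, (p.union d.unmarked).fullyMarked_deleteUnmarked⟩
  exact ⟨p.union d.unmarked, isMinimalMarking_of_strictMarks hV hsum hunion,
    Quotient.sound (MarkedColoredPartition.rowEquiv_deleteUnmarked_union hstrict.nonneg hfull d),
    fun i j hij hj => (hlt i j hij hj).1⟩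

theorem isCharacteristicBipartition_iff [NeZero n] (hV : DirectSum.IsInternal V) :
    IsCharacteristicBipartition V (MarkedColoredPartitionClass.mk p) ↔
      p.signature ≤ spaceSignature V ∧ p.StrictMarks ∧ p.FullyMarked :=
  ⟨strictMarks_of_isCharacteristicBipartition hV, fun ⟨hsig, hstrict, hfull⟩ =>
    isCharacteristicBipartition_of_strictMarks hV hsig hstrict hfull⟩

theorem Psi_union_unmarked_mem_enhancedOrbits (hV : DirectSum.IsInternal V)
    (hsig : p.signature + d.signature = spaceSignature V) (hp : p.StrictMarks) :
    Psi V (p.union d.unmarked) ∈ enhancedOrbits V :=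
  (Psi_mem_enhancedOrbits_iff hV ((p.signature_union d.unmarked).trans hsig)).mpr
    (hp.union_unmarked d).monochromatic

theorem rowEquiv_of_Psi_union_unmarked_eq (hV : DirectSum.IsInternal V)
    (hsig : p.signature + d.signature = spaceSignature V)
    (hp : p.StrictMarks) (hfull : p.FullyMarked) (hp' : p'.StrictMarks) (hfull' : p'.FullyMarked)
    (h : Psi V (p.union d.unmarked) = Psi V (p'.union d'.unmarked)) :
    p.RowEquiv p' ∧ d.RowEquiv d' := by
  obtain ⟨x, B, C, hB, hC, hBC⟩ :=
    exists_isColoredJordanBasis_of_Psi_eq hV ((p.signature_union d.unmarked).trans hsig) h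
  have hpp' : p.RowEquiv p' := by
    refine MarkedColoredPartition.rowEquiv_of_fullyMarked hp.nonneg hp'.nonneg hfull hfull'
      fun t ht => ?_
    rw [← MarkedColoredPartition.valueCount_row_union_unmarked p d ht.ne',
      ← MarkedColoredPartition.valueCount_row_union_unmarked p' d' ht.ne']
    exact hB.valueCount_row_eq hV hC (hp.union_unmarked d) (hp'.union_unmarked d') hBC ht
  refine ⟨hpp', ColoredPartition.rowEquiv_of_valueCount_eq fun t ht => ?_⟩
  have hshape := ColoredPartition.rowEquiv_iff.mp (hB.rowEquiv hV hC) t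
  rw [MarkedColoredPartition.valueCount_shape_union, MarkedColoredPartition.valueCount_shape_union,
    ColoredPartition.rowEquiv_iff.mp hpp'.shape t] at hshape
  exact ENat.add_right_injective_of_ne_top (p'.valueCount_row_ne_top ht) hshape

theorem exists_Psi_union_unmarked_eq [NeZero n] (hV : DirectSum.IsInternal V)
    {O : Set (W × Module.End F W)} (hO : O ∈ enhancedOrbits V) :
    ∃ (p : MarkedColoredPartition n) (d : ColoredPartition n),
      p.signature + d.signature = spaceSignature V ∧ p.StrictMarks ∧ p.FullyMarked ∧
        Psi V (p.union d.unmarked) = O := by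
  obtain ⟨q, hsig, hstrict, rfl⟩ := exists_strictMarks_Psi_eq hV hO
  have hequiv := MarkedColoredPartition.union_unmarkedPart_rowEquiv hstrict.nonneg
  refine ⟨q.deleteUnmarked, q.unmarkedPart, ?_, hstrict.deleteUnmarked,
    q.fullyMarked_deleteUnmarked, ?_⟩
  · rw [MarkedColoredPartition.signature_deleteUnmarked_add hstrict.nonneg, hsig]
  · exact congrArg (PsiClass V) (Quotient.sound hequiv)

end Characteristic

theorem mainTheorem9 {n : ℕ} [NeZero n] {F W : Type*} [Field F] [AddCommGroup W] [Module F W]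
    [FiniteDimensional F W] (V : ZMod n → Submodule F W) (hV : DirectSum.IsInternal V) :
    Set.BijOn
      (fun cd : MarkedColoredPartitionClass n × ColoredPartitionClass n =>
        PsiClass V (cd.1.union cd.2.toMarked))
      {cd | cd.1.signature + cd.2.signature = spaceSignature V ∧
        IsCharacteristicBipartition V cd.1}
      (enhancedOrbits V) ∧
    ∀ p : MarkedColoredPartition n,
      IsCharacteristicBipartition V (MarkedColoredPartitionClass.mk p) ↔
        p.signature ≤ spaceSignature V ∧
        (∀ i, i < p.length → 0 < p.mark i) ∧
        (∀ i, p.length ≤ i → p.mark i = 0) ∧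
        (∀ i j, i < j → j < p.length → p.markColor i = p.markColor j ∧
          p.mark j < p.mark i ∧ p.len j - p.mark j < p.len i - p.mark i) := by
  refine ⟨⟨?_, ?_, fun O hO => ?_⟩, fun p => ?_⟩
  · rintro ⟨⟨p⟩, ⟨d⟩⟩ ⟨hsig, hchar⟩
    obtain ⟨-, hp, -⟩ := (isCharacteristicBipartition_iff hV).mp hchar
    exact Psi_union_unmarked_mem_enhancedOrbits hV hsig hp
  · rintro ⟨⟨p⟩, ⟨d⟩⟩ ⟨hsig, hchar⟩ ⟨⟨p'⟩, ⟨d'⟩⟩ ⟨-, hchar'⟩ hPsi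
    obtain ⟨-, hp, hfull⟩ := (isCharacteristicBipartition_iff hV).mp hchar
    obtain ⟨-, hp', hfull'⟩ := (isCharacteristicBipartition_iff hV).mp hchar'
    obtain ⟨hpp', hdd'⟩ := rowEquiv_of_Psi_union_unmarked_eq hV hsig hp hfull hp' hfull' hPsi
    exact Prod.ext (Quotient.sound hpp') (Quotient.sound hdd')
  · obtain ⟨p, d, hsig, hp, hfull, hPsi⟩ := exists_Psi_union_unmarked_eq hV hO
    exact ⟨(.mk p, Quotient.mk _ d), ⟨hsig, (isCharacteristicBipartition_iff hV).mpr
      ⟨le_self_add.trans_eq hsig, hp, hfull⟩⟩, hPsi⟩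
  · rw [isCharacteristicBipartition_iff hV, p.strictMarks_and_fullyMarked_iff]
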